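/- Let $F$ be a nonarchimedean local field (of any characteristic) whose residue field $\mathfrak f$ has characteristic $2$. Let $\mathcal R$ be its ring of integers, $\mathcal P$ the maximal ideal of $\mathcal R$, $\varpi$ a uniformizer, and $\psi$ an additive character of $F$ that is trivial on $\mathcal P$ but not on $\mathcal R$. Let $\mathcal K=\mathrm{GL}(2,\mathcal R)$, and for $n\ge 1$ let $\mathcal K_n$ be the kernel of $\mathcal K\to \mathrm{GL}(2,\mathcal R/\mathcal P^n)$. All representations are smooth and complex; $\mathrm{Ind}_H^{\mathcal K}\rho$ is the space of locally constant $f$ on $\mathcal K$ with $f(hg)=\rho(h)f(g)$ for $h\in H$, with $\mathcal K$ acting by right translation; and the depth of a representation of $\mathcal K$ is the least integer $d\ge 0$ such that it has a nonzero $\mathcal K_{d+1}$-fixed vector. Let $\ell\ge 1$ be an integer, $m=\lceil \ell/2\rceil$ and $m'=\lfloor \ell/2\rfloor+1$. Let $\Gamma(\ell)$ be the group of all $g=(g_{ij})\in\mathcal K$ with $g_{12}\in\mathcal P^{m'}$ and $g_{11}-g_{22}\in\mathcal P^{m}$. For a character $\zeta$ of $\mathcal R^\times$ trivial on $1+\mathcal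 P^m$ put $$J(\zeta,\ell)=\mathrm{Ind}_{\Gamma(\ell)}^{\mathcal K}\hat\eta_{\zeta,\ell},\qquad \hat\eta_{\zeta,\ell}(g)=\zeta(g_{11})\,\psi(\varpi^{-\ell}g_{11}^{-1}g_{12}).$$ Let $g_\ell=\mathrm{diag}(\varpi^\ell,1)$, let $B_\ell$ be the group of matrices in $\mathcal K$ that are lower triangular modulo $\mathcal P^\ell$, and for a representation $\sigma$ of $\mathcal K$ let ${}^{g_\ell}\sigma$ be the representation $b\mapsto\sigma(g_\ell^{-1}bg_\ell)$ of $B_\ell$. **Proposition.** Let $\sigma$ be the inflation to $\mathcal K$ of a cuspidal representation of $\mathrm{GL}(2,\mathfrak f)$ with central character $\omega$, and regard $\omega$ also as a character of $\mathcal R^\times$ by inflation from $\mathfrak f^\times$. Then for every $\ell\ge1$ $$J(\omega,\ell)\;\cong\;\mathrm{Ind}_{B_\ell}^{\mathcal K}\,{}^{g_\ell}\sigma$$ as representations of $\mathcal K$, and this representation is irreducible and of depth $\ell$. -/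

import Mathlib

open scoped ValuativeRel MatrixGroups

noncomputable section

namespace BranchGL2

/-! ### Smooth induction -/

section Induction

variable {G : Type*} [Group G] [TopologicalSpace G] [IsTopologicalGroup G]
variable {W : Type*} [AddCommGroup W] [Module ℂ W]

/-- The space of `c-Ind_H^G ρ`: locally constant functions `f : G → W`, compactly supported
modulo `H`, with `f (h g) = ρ(h) f(g)`. (When `G` is compact the support condition is automatic
and this is the space of `Ind_H^G ρ`.) -/
def indSpace (H : Subgroup G) (ρ : Representation ℂ H W) : Submodule ℂ (G → W) where
  carrier := {f | (∀ (h : H) (g : G), f (h * g) = ρ h (f g)) ∧ IsLocallyConstant f ∧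
    ∃ C : Set G, IsCompact C ∧ ∀ g, f g ≠ 0 → ∃ h : H, ∃ c ∈ C, g = h * c}
  zero_mem' := ⟨fun h g => by simp, IsLocallyConstant.const 0, ∅, isCompact_empty,
    fun g hg => absurd rfl hg⟩
  add_mem' := by
    rintro f₁ f₂ ⟨h1, l1, C1, k1, s1⟩ ⟨h2, l2, C2, k2, s2⟩
    refine ⟨fun h g => by simp [h1, h2], l1.add l2, C1 ∪ C2, k1.union k2, fun g hg => ?_⟩
    by_cases hf : f₁ g = 0
    · have : f₂ g ≠ 0 := fun h0 => hg (by simp [hf, h0])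
      obtain ⟨h, c, hc, e⟩ := s2 g this
      exact ⟨h, c, Or.inr hc, e⟩
    · obtain ⟨h, c, hc, e⟩ := s1 g hf
      exact ⟨h, c, Or.inl hc, e⟩
  smul_mem' := by
    rintro a f ⟨h1, l1, C1, k1, s1⟩
    refine ⟨fun h g => by simp [h1], l1.comp (fun w => a • w), C1, k1, fun g hg => ?_⟩
    exact s1 g fun h0 => hg (by simp [h0])

/-- `Ind_H^G ρ`, with `G` acting by right translation: `(x · f)(g) = f (g x)`. -/
def ind (H : Subgroup G) (ρ : Representation ℂ H W) : Representation ℂ G (indSpace H ρ) where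
  toFun x :=
    { toFun := fun f => ⟨fun g => f.1 (g * x), by
        obtain ⟨f, h1, l1, C, k1, s1⟩ := f
        refine ⟨fun h g => by simp [mul_assoc, h1], l1.comp_continuous (continuous_mul_const x),
          (fun c => c * x⁻¹) '' C, k1.image (continuous_mul_const _), fun g hg => ?_⟩
        obtain ⟨h, c, hc, e⟩ := s1 _ hg
        exact ⟨h, c * x⁻¹, ⟨c, hc, rfl⟩, by rw [← mul_assoc, ← e]; simp⟩⟩
      map_add' := fun _ _ => rfl
      map_smul' := fun _ _ => rfl }
  map_one' := by ext f g; simp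
  map_mul' x y := by ext f g; simp [mul_assoc]

/-- The one-dimensional representation attached to a character. -/
def charRep {A : Type*} [Monoid A] (χ : A →* ℂ) : Representation ℂ A ℂ where
  toFun a := χ a • LinearMap.id
  map_one' := by ext; simp
  map_mul' a b := by ext; simp [mul_comm]

end Induction

/-! ### Cuspidal representations of `GL(2)` of a field -/

section Cuspidal

variable {k : Type*} [Field k] {V : Type*} [AddCommGroup V] [Module ℂ V]

/-- The unipotent matrix `[1 x; 0 1]`. -/
def unip (x : k) : GL (Fin 2) k :=
  Matrix.GeneralLinearGroup.mkOfDetNeZero !![1, x; 0, 1] (by simp)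

/-- `σ` is cuspidal: it is irreducible and its restriction to the unipotent radical
of the standard Borel subgroup (all of which are conjugate) has no nonzero fixed vector. -/
def IsCuspidal (σ : Representation ℂ (GL (Fin 2) k) V) : Prop :=
  σ.IsIrreducible ∧ ∀ v : V, (∀ x : k, σ (unip x) v = v) → v = 0

/-- The centre of `GL(2, k)` acts through `ω`. -/
def HasCentralCharacter (σ : Representation ℂ (GL (Fin 2) k) V) (ω : kˣ →* ℂˣ) : Prop :=
  ∀ (a : kˣ) (v : V), σ (Matrix.GeneralLinearGroup.scalar (Fin 2) a) v = (ω a : ℂ) • v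

end Cuspidal

/-! ### The group `K = GL(2, R)` and its representations -/

section Local

variable {F : Type*} [Field F] [ValuativeRel F] [TopologicalSpace F]
  [IsNonarchimedeanLocalField F]

/-- An additive character of `F` of conductor `P`: trivial on `P` but not on `R`. -/
structure HasConductorP (ψ : AddChar F ℂ) : Prop where
  trivial : ∀ x : 𝒪[F], x ∈ 𝓂[F] → ψ (x : F) = 1
  nontrivial : ∃ x : 𝒪[F], ψ (x : F) ≠ 1

variable (F) in
/-- The `n`-th congruence subgroup `K_n` of `K = GL(2, R)` (with `K_0 = K`). -/
def congrSub (n : ℕ) : Subgroup (GL (Fin 2) 𝒪[F]) :=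
  (Matrix.GeneralLinearGroup.map (n := Fin 2) (Ideal.Quotient.mk (𝓂[F] ^ n))).ker

/-- `π` has depth `d`: `d` is the least integer `≥ 0` such that `π` has a nonzero vector fixed by
`K_{d+} = K_{d+1}`. -/
def HasDepth {V : Type*} [AddCommGroup V] [Module ℂ V]
    (π : Representation ℂ (GL (Fin 2) 𝒪[F]) V) (d : ℕ) : Prop :=
  IsLeast {n : ℕ | ∃ v : V, v ≠ 0 ∧ ∀ k ∈ congrSub F (n + 1), π k v = v} d

theorem inv_zero_one {A : Type*} [CommRing A] (g : GL (Fin 2) A) :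
    (g⁻¹) 0 1 = -(((g.det⁻¹ : Aˣ) : A) * g 0 1) := by
  rw [Matrix.coe_units_inv, Matrix.inv_def, Matrix.adjugate_fin_two]
  rw [← Matrix.GeneralLinearGroup.val_det_apply, Ring.inverse_unit]
  simp

theorem inv_sub {A : Type*} [CommRing A] (g : GL (Fin 2) A) :
    (g⁻¹) 0 0 - (g⁻¹) 1 1 = -(((g.det⁻¹ : Aˣ) : A) * (g 0 0 - g 1 1)) := by
  rw [Matrix.coe_units_inv, Matrix.inv_def, Matrix.adjugate_fin_two]
  rw [← Matrix.GeneralLinearGroup.val_det_apply, Ring.inverse_unit]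
  simp
  ring

variable (F) in
/-- `B_ℓ`: the matrices of `K` that are lower triangular modulo `P^ℓ`. -/
def lowerTri (l : ℕ) : Subgroup (GL (Fin 2) 𝒪[F]) where
  carrier := {g | g 0 1 ∈ 𝓂[F] ^ l}
  one_mem' := by simp
  mul_mem' := by
    intro a b ha hb
    simp only [Set.mem_ofPred_eq] at *
    rw [Units.val_mul, Matrix.mul_apply, Fin.sum_univ_two]
    exact add_mem (Ideal.mul_mem_left _ _ hb) (Ideal.mul_mem_right _ _ ha)
  inv_mem' := by
    intro a ha
    simp only [Set.mem_ofPred_eq] at *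
    rw [inv_zero_one]
    exact neg_mem (Ideal.mul_mem_left _ _ ha)

/-- `m = ⌈ℓ/2⌉`. -/
def mLow (l : ℕ) : ℕ := (l + 1) / 2

/-- `m' = ⌊ℓ/2⌋ + 1`. -/
def mUp (l : ℕ) : ℕ := l / 2 + 1

variable (F) in
/-- `Γ(ℓ) = Z₀ U₀ K_{m,m'}`, i.e. the matrices `g` of `K` with `g₁₂ ∈ P^{m'}` and
`g₁₁ - g₂₂ ∈ P^m`. -/
def Gam (l : ℕ) : Subgroup (GL (Fin 2) 𝒪[F]) where
  carrier := {g | g 0 1 ∈ 𝓂[F] ^ mUp l ∧ g 0 0 - g 1 1 ∈ 𝓂[F] ^ mLow l}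
  one_mem' := by simp
  mul_mem' := by
    rintro a b ⟨ha, ha'⟩ ⟨hb, hb'⟩
    have hle : 𝓂[F] ^ mUp l ≤ 𝓂[F] ^ mLow l :=
      Ideal.pow_le_pow_right (by unfold mUp mLow; omega)
    refine ⟨?_, ?_⟩
    · rw [Units.val_mul, Matrix.mul_apply, Fin.sum_univ_two]
      exact add_mem (Ideal.mul_mem_left _ _ hb) (Ideal.mul_mem_right _ _ ha)
    · have : (a * b) 0 0 - (a * b) 1 1 = a 0 0 * (b 0 0 - b 1 1) + b 1 1 * (a 0 0 - a 1 1)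
          + (b 1 0 * a 0 1 - a 1 0 * b 0 1) := by
        simp only [Units.val_mul, Matrix.mul_apply, Fin.sum_univ_two]; ring
      rw [this]
      exact add_mem (add_mem (Ideal.mul_mem_left _ _ hb') (Ideal.mul_mem_left _ _ ha'))
        (sub_mem (Ideal.mul_mem_left _ _ (hle ha)) (Ideal.mul_mem_left _ _ (hle hb)))
  inv_mem' := by
    rintro a ⟨ha, ha'⟩
    refine ⟨?_, ?_⟩
    · rw [inv_zero_one]
      exact neg_mem (Ideal.mul_mem_left _ _ ha)
    · rw [inv_sub]
      exact neg_mem (Ideal.mul_mem_left _ _ ha')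

theorem Gam.isUnit {l : ℕ} (g : Gam F l) : IsUnit (g.1 0 0) := by
  have h1 : g.1 0 1 ∈ 𝓂[F] := Ideal.pow_le_self (by simp [mUp]) g.2.1
  have hd : IsUnit (g.1 0 0 * g.1 1 1 - g.1 0 1 * g.1 1 0) := by
    rw [← Matrix.det_fin_two]
    exact (Matrix.isUnit_iff_isUnit_det _).1 g.1.isUnit
  by_contra hn
  have h0 : g.1 0 0 ∈ 𝓂[F] := (IsLocalRing.mem_maximalIdeal _).2 hn
  exact (IsLocalRing.mem_maximalIdeal _).1
    (sub_mem (Ideal.mul_mem_right _ _ h0) (Ideal.mul_mem_right _ _ h1)) hd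

/-- The entry `g₁₁ ∈ Rˣ` of `g ∈ Γ(ℓ)`. -/
def Gam.a {l : ℕ} (g : Gam F l) : (𝒪[F])ˣ := (Gam.isUnit g).unit

/-- A character `ζ` of `Rˣ` is trivial on `1 + P^m` (for `m ≥ 1`: it has depth less than `m`). -/
def TrivialOn (ζ : (𝒪[F])ˣ →* ℂˣ) (m : ℕ) : Prop :=
  ∀ x : (𝒪[F])ˣ, (x : 𝒪[F]) - 1 ∈ 𝓂[F] ^ m → ζ x = 1

/-- Inflation to `Rˣ` of a character of the multiplicative group of the residue field. -/
def inflChar (ω : (𝓀[F])ˣ →* ℂˣ) : (𝒪[F])ˣ →* ℂˣ :=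
  ω.comp (Units.map (IsLocalRing.residue 𝒪[F]).toMonoidHom)

theorem inflChar_trivialOn (ω : (𝓀[F])ˣ →* ℂˣ) {l : ℕ} (hl : 1 ≤ l) :
    TrivialOn (inflChar ω) (mLow l) := by
  intro x hx
  have h1 : (x : 𝒪[F]) - 1 ∈ 𝓂[F] := Ideal.pow_le_self (by unfold mLow; omega) hx
  have : Units.map (IsLocalRing.residue 𝒪[F]).toMonoidHom x = 1 := by
    ext
    have := (IsLocalRing.residue_eq_zero_iff _).2 h1
    rw [map_sub, sub_eq_zero] at this
    simpa using this
  rw [inflChar, MonoidHom.comp_apply, this, map_one]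

theorem psi_congr {ψ : AddChar F ℂ} (hψ : HasConductorP ψ) {ϖ : 𝒪[F]} (hϖ : Irreducible ϖ)
    (l : ℕ) {x y : 𝒪[F]} (h : x - y ∈ 𝓂[F] ^ (l + 1)) :
    ψ (((ϖ : F) ^ l)⁻¹ * x) = ψ (((ϖ : F) ^ l)⁻¹ * y) := by
  rw [hϖ.maximalIdeal_eq, Ideal.span_singleton_pow, Ideal.mem_span_singleton] at h
  obtain ⟨c, hc⟩ := h
  have h0 : (ϖ : F) ≠ 0 := by simpa using hϖ.ne_zero
  have hx : (x : F) = y + (ϖ : F) ^ (l + 1) * c := by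
    have := congrArg (Subtype.val) hc
    push_cast at this
    linear_combination this
  have hm : ϖ * c ∈ 𝓂[F] := by
    rw [hϖ.maximalIdeal_eq]; exact Ideal.mem_span_singleton.2 ⟨c, rfl⟩
  have : ((ϖ : F) ^ l)⁻¹ * x = ((ϖ : F) ^ l)⁻¹ * y + ((ϖ * c : 𝒪[F]) : F) := by
    rw [hx]; push_cast; field_simp; ring
  rw [this, AddChar.map_add_eq_mul, hψ.trivial _ hm, mul_one]

theorem Gam.a_one {l : ℕ} : Gam.a (1 : Gam F l) = 1 := by
  ext; simp [Gam.a]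

theorem Gam.a_mul {ζ : (𝒪[F])ˣ →* ℂˣ} {l : ℕ} (hζ : TrivialOn ζ (mLow l)) (g h : Gam F l) :
    ζ (Gam.a (g * h)) = ζ (Gam.a g) * ζ (Gam.a h) := by
  have key : ζ (Gam.a (g * h) * (Gam.a g * Gam.a h)⁻¹) = 1 := by
    apply hζ
    have e : ((Gam.a (g * h) * (Gam.a g * Gam.a h)⁻¹ : (𝒪[F])ˣ) : 𝒪[F]) - 1
        = (((Gam.a g * Gam.a h)⁻¹ : (𝒪[F])ˣ) : 𝒪[F]) * h.1 1 0 * g.1 0 1 := by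
      have e1 : ((Gam.a (g * h) : (𝒪[F])ˣ) : 𝒪[F])
          = (Gam.a g * Gam.a h : (𝒪[F])ˣ) + h.1 1 0 * g.1 0 1 := by
        simp [Gam.a, Matrix.mul_apply, Fin.sum_univ_two, mul_comm]
      have e2 : ((Gam.a g * Gam.a h : (𝒪[F])ˣ) : 𝒪[F]) * ((Gam.a g * Gam.a h)⁻¹ : (𝒪[F])ˣ) = 1 :=
        Units.mul_inv _
      rw [Units.val_mul, e1, add_mul, e2]
      ring
    rw [e]
    exact Ideal.mul_mem_left _ _ (Ideal.pow_le_pow_right (by unfold mUp mLow; omega) g.2.1)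
  rw [map_mul, map_inv, mul_inv_eq_one] at key
  rw [key, map_mul]

theorem Gam.b_mul {l : ℕ} (g h : Gam F l) :
    (((Gam.a (g * h))⁻¹ : (𝒪[F])ˣ) : 𝒪[F]) * (g * h).1 0 1 -
      ((((Gam.a g)⁻¹ : (𝒪[F])ˣ) : 𝒪[F]) * g.1 0 1 + (((Gam.a h)⁻¹ : (𝒪[F])ˣ) : 𝒪[F]) * h.1 0 1)
      ∈ 𝓂[F] ^ (l + 1) := by
  have hA : ((Gam.a (g * h) : (𝒪[F])ˣ) : 𝒪[F])
      = (Gam.a g : 𝒪[F]) * Gam.a h + g.1 0 1 * h.1 1 0 := by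
    simp [Gam.a, Matrix.mul_apply, Fin.sum_univ_two]
  have hB : (g * h).1 0 1 = (Gam.a g : 𝒪[F]) * h.1 0 1 + g.1 0 1 * h.1 1 1 := by
    simp [Gam.a, Matrix.mul_apply, Fin.sum_univ_two]
  have hd : (Gam.a h : 𝒪[F]) - h.1 1 1 ∈ 𝓂[F] ^ mLow l := h.2.2
  have hg := g.2.1
  have hh := h.2.1
  have p1 : ∀ {x y : 𝒪[F]}, x ∈ 𝓂[F] ^ mUp l → y ∈ 𝓂[F] ^ mUp l → x * y ∈ 𝓂[F] ^ (l + 1) := by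
    intro x y hx hy
    have := Ideal.mul_mem_mul hx hy
    rw [← pow_add] at this
    exact Ideal.pow_le_pow_right (by unfold mUp; omega) this
  have p2 : g.1 0 1 * ((Gam.a h : 𝒪[F]) - h.1 1 1) ∈ 𝓂[F] ^ (l + 1) := by
    have := Ideal.mul_mem_mul hg hd
    rw [← pow_add] at this
    exact Ideal.pow_le_pow_right (by unfold mUp mLow; omega) this
  have i1 : (Gam.a g : 𝒪[F]) * ((Gam.a g)⁻¹ : (𝒪[F])ˣ) = 1 := Units.mul_inv _
  have i2 : (Gam.a h : 𝒪[F]) * ((Gam.a h)⁻¹ : (𝒪[F])ˣ) = 1 := Units.mul_inv _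
  have i3 : (Gam.a (g * h) : 𝒪[F]) * ((Gam.a (g * h))⁻¹ : (𝒪[F])ˣ) = 1 := Units.mul_inv _
  rw [← Ideal.unit_mul_mem_iff_mem _
    ((Gam.a (g * h)).isUnit.mul ((Gam.a g).isUnit.mul (Gam.a h).isUnit))]
  generalize (((Gam.a (g * h))⁻¹ : (𝒪[F])ˣ) : 𝒪[F]) = Ai at *
  generalize (((Gam.a g)⁻¹ : (𝒪[F])ˣ) : 𝒪[F]) = ai at *
  generalize (((Gam.a h)⁻¹ : (𝒪[F])ˣ) : 𝒪[F]) = bi at *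
  generalize ((Gam.a (g * h) : (𝒪[F])ˣ) : 𝒪[F]) = A at *
  generalize ((Gam.a g : (𝒪[F])ˣ) : 𝒪[F]) = a at *
  generalize ((Gam.a h : (𝒪[F])ˣ) : 𝒪[F]) = b at *
  have : A * (a * b) * (Ai * (g * h).1 0 1 - (ai * g.1 0 1 + bi * h.1 0 1))
      = -(a * b) * (g.1 0 1 * (b - h.1 1 1)) - (b * h.1 1 0) * (g.1 0 1 * g.1 0 1)
        - (a * h.1 1 0) * (g.1 0 1 * h.1 0 1) := by
    have e : A * (a * b) * (Ai * (g * h).1 0 1 - (ai * g.1 0 1 + bi * h.1 0 1))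
      = (A * Ai) * (a * b) * (g * h).1 0 1 - A * b * (a * ai) * g.1 0 1
        - A * a * (b * bi) * h.1 0 1 := by ring
    rw [e, i1, i2, i3, hB, hA]
    ring
  rw [this]
  exact sub_mem (sub_mem (Ideal.mul_mem_left _ _ p2) (Ideal.mul_mem_left _ _ (p1 hg hg)))
    (Ideal.mul_mem_left _ _ (p1 hg hh))

/-- The character `g ↦ ζ(g₁₁) ψ(ϖ^{-ℓ} g₁₁⁻¹ g₁₂)` of `Γ(ℓ)`. -/
def etaHat (ψ : AddChar F ℂ) (hψ : HasConductorP ψ) (ϖ : 𝒪[F]) (hϖ : Irreducible ϖ)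
    (ζ : (𝒪[F])ˣ →* ℂˣ) (l : ℕ) (hζ : TrivialOn ζ (mLow l)) : Gam F l →* ℂ where
  toFun g := (ζ (Gam.a g) : ℂ) *
    ψ (((ϖ : F) ^ l)⁻¹ * ((((Gam.a g)⁻¹ : (𝒪[F])ˣ) : 𝒪[F]) * g.1 0 1 : 𝒪[F]))
  map_one' := by simp [Gam.a_one]
  map_mul' g h := by
    rw [Gam.a_mul hζ, psi_congr hψ hϖ l (Gam.b_mul g h)]
    rw [Subring.coe_add, mul_add, AddChar.map_add_eq_mul, Units.val_mul]
    ring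

/-- `J(ζ, ℓ) = Ind_{Γ(ℓ)}^K η̂_{ζ,ℓ}`. -/
def J (ψ : AddChar F ℂ) (hψ : HasConductorP ψ) (ϖ : 𝒪[F]) (hϖ : Irreducible ϖ)
    (ζ : (𝒪[F])ˣ →* ℂˣ) (l : ℕ) (hζ : TrivialOn ζ (mLow l)) :
    Representation ℂ (GL (Fin 2) 𝒪[F])
      (indSpace (Gam F l) (charRep (etaHat ψ hψ ϖ hϖ ζ l hζ))) :=
  ind (Gam F l) (charRep (etaHat ψ hψ ϖ hϖ ζ l hζ))

/-- The inclusion `K = GL(2, R) → GL(2, F)`. -/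
def incl : GL (Fin 2) 𝒪[F] →* GL (Fin 2) F :=
  Matrix.GeneralLinearGroup.map (algebraMap 𝒪[F] F)

theorem incl_injective : Function.Injective (incl (F := F)) := by
  intro a b h
  ext i j
  have := congrArg (fun x : GL (Fin 2) F => x i j) h
  simpa [incl, Matrix.GeneralLinearGroup.map_apply] using this

/-- `g_ℓ = diag(ϖ^ℓ, 1) ∈ GL(2, F)`. -/
def gEll (ϖ : 𝒪[F]) (hϖ : Irreducible ϖ) (l : ℕ) : GL (Fin 2) F :=
  Matrix.GeneralLinearGroup.mkOfDetNeZero !![(ϖ : F) ^ l, 0; 0, 1]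
    (by simpa using fun h => absurd h hϖ.ne_zero)

theorem exists_conj {ϖ : 𝒪[F]} (hϖ : Irreducible ϖ) {l : ℕ} (b : lowerTri F l) :
    ∃ k : GL (Fin 2) 𝒪[F], incl k = (gEll ϖ hϖ l)⁻¹ * incl b.1 * gEll ϖ hϖ l := by
  have hb : b.1 0 1 ∈ 𝓂[F] ^ l := b.2
  rw [hϖ.maximalIdeal_eq, Ideal.span_singleton_pow, Ideal.mem_span_singleton] at hb
  obtain ⟨c, hc⟩ := hb
  have hd : IsUnit (Matrix.det !![b.1 0 0, c; ϖ ^ l * b.1 1 0, b.1 1 1]) := by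
    have h := (Matrix.isUnit_iff_isUnit_det _).1 b.1.isUnit
    rw [Matrix.det_fin_two, hc] at h
    rw [Matrix.det_fin_two_of]
    convert h using 1
    ring
  obtain ⟨k, hk⟩ : ∃ k : GL (Fin 2) 𝒪[F], k.1 = !![b.1 0 0, c; ϖ ^ l * b.1 1 0, b.1 1 1] :=
    ⟨Matrix.GeneralLinearGroup.mk'' _ hd, rfl⟩
  refine ⟨k, ?_⟩
  rw [mul_assoc, eq_inv_mul_iff_mul_eq]
  have halg : ∀ x : 𝒪[F], algebraMap 𝒪[F] F x = x := fun _ => rfl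
  ext i j
  rw [Units.val_mul, Units.val_mul, Matrix.mul_apply, Matrix.mul_apply]
  fin_cases i <;> fin_cases j <;>
    simp [Fin.sum_univ_two, gEll, incl, Matrix.GeneralLinearGroup.mkOfDetNeZero, hk, hc, halg,
      mul_comm]

/-- The homomorphism `B_ℓ → K`, `b ↦ g_ℓ⁻¹ b g_ℓ` (characterised by `incl_conj`). -/
def conj (ϖ : 𝒪[F]) (hϖ : Irreducible ϖ) (l : ℕ) : lowerTri F l →* GL (Fin 2) 𝒪[F] where
  toFun b := (exists_conj hϖ b).choose
  map_one' := by
    apply incl_injective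
    rw [(exists_conj hϖ (1 : lowerTri F l)).choose_spec]
    simp
  map_mul' a b := by
    apply incl_injective
    rw [map_mul, (exists_conj hϖ (a * b)).choose_spec, (exists_conj hϖ a).choose_spec,
      (exists_conj hϖ b).choose_spec, Subgroup.coe_mul, map_mul]
    group

theorem incl_conj (ϖ : 𝒪[F]) (hϖ : Irreducible ϖ) (l : ℕ) (b : lowerTri F l) :
    incl (conj ϖ hϖ l b) = (gEll ϖ hϖ l)⁻¹ * incl b.1 * gEll ϖ hϖ l :=
  (exists_conj hϖ b).choose_spec

/-- Inflation to `K = GL(2, R)` of a representation of `GL(2)` of the residue field. -/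
def infl {V : Type*} [AddCommGroup V] [Module ℂ V] (σ : Representation ℂ (GL (Fin 2) 𝓀[F]) V) :
    Representation ℂ (GL (Fin 2) 𝒪[F]) V :=
  σ.comp (Matrix.GeneralLinearGroup.map (IsLocalRing.residue 𝒪[F]))

/-- The representation `b ↦ τ(g_ℓ⁻¹ b g_ℓ)` of `B_ℓ`, for a representation `τ` of `K`. -/
def twist {V : Type*} [AddCommGroup V] [Module ℂ V] (ϖ : 𝒪[F]) (hϖ : Irreducible ϖ) (l : ℕ)
    (τ : Representation ℂ (GL (Fin 2) 𝒪[F]) V) : Representation ℂ (lowerTri F l) V :=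
  τ.comp (conj ϖ hϖ l)

/-- The Mackey component `Ind_{B_ℓ}^K (^{g_ℓ} σ)`, for `σ` inflated to `K`. -/
def mackey {V : Type*} [AddCommGroup V] [Module ℂ V] (ϖ : 𝒪[F]) (hϖ : Irreducible ϖ) (l : ℕ)
    (σ : Representation ℂ (GL (Fin 2) 𝓀[F]) V) :
    Representation ℂ (GL (Fin 2) 𝒪[F]) (indSpace (lowerTri F l) (twist ϖ hϖ l (infl σ))) :=
  ind (lowerTri F l) (twist ϖ hϖ l (infl σ))

end Local

end BranchGL2

end

/-! Both sides are compared with a third induced representation. Let H be the group `nearScalar F l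
1` of matrices with g₁₂ ∈ P^ℓ and g₁₁ - g₂₂ ∈ P. Conjugation by g_ℓ followed by reduction mod P
sends B_ℓ into the upper triangular Borel subgroup of GL(2, 𝔣), and H into its subgroup ZU.

A cuspidal σ has a Whittaker functional L for the character θ of U induced by ψ. On H it transforms
by a character χ, which is given by ω and ψ. Hence f ↦ L ∘ f maps the Mackey component to Ind_H^K χ.
By Gelfand's trick the θ-projector has rank one on V (`sandwich_comm`, `exists_scalar_sandwich`).
Together with cuspidality and Fourier inversion on U (`eq_zero_of_whittakerIdem`) this shows that
the Borel translates of L separate vectors, so the map is injective (`IsCuspidal.exists_whittaker`).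

The groups H and Γ(ℓ) have the same shape, g₁₂ ∈ P^p and g₁₁ - g₂₂ ∈ P^r with p + r = ℓ + 1. For
this shape a Mackey criterion (`ind_isIrreducible`, `eq_zero_of_biequivariant`) proves
irreducibility of both Ind_H^K χ and J(ω, ℓ). A nonzero representation embedded in an irreducible
one fills it, so the Mackey component is isomorphic to Ind_H^K χ without any count of dimensions.

The characters of Γ(ℓ) and H are given by the same formula on the intersection, so averaging yields
a nonzero intertwining map (`average_ne_zero`), which is bijective by Schur's lemma. As for depth,
K_{ℓ+1} is normal and acts trivially on the inducing data, hence on the whole induced space. A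
K_ℓ-fixed function takes values fixed by U, and these vanish by cuspidality. -/

noncomputable section

namespace BranchGL2

/-! ### Induction from open subgroups of finite index, and a Mackey irreducibility criterion -/

section FiniteLevel

/-- Translation invariance of a sum over the cosets of a subgroup. -/
theorem sum_out_mul_left {S E : Type*} [Group S] [AddCommMonoid E] (N : Subgroup S)
    [Fintype (S ⧸ N)] (c : S → E) (hc : ∀ s, ∀ n ∈ N, c (s * n) = c s) (t : S) :
    ∑ q : S ⧸ N, c (t * q.out) = ∑ q : S ⧸ N, c q.out := by
  refine Fintype.sum_equiv (MulAction.toPerm t) _ _ fun q => ?_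
  have h : ((t * q.out : S) : S ⧸ N) = (((t • q).out : S) : S ⧸ N) := by
    rw [QuotientGroup.out_eq', ← smul_eq_mul, ← MulAction.Quotient.smul_coe,
      QuotientGroup.out_eq']
  rw [QuotientGroup.eq] at h
  have := hc (t * q.out) _ h
  rw [mul_inv_cancel_left] at this
  exact this.symm

variable {G : Type*} [Group G] [TopologicalSpace G] [IsTopologicalGroup G]
variable {W : Type*} [AddCommGroup W] [Module ℂ W]

/-- Equivariant functions invariant under an open subgroup of finite index lie in the induced
space. -/
theorem mem_indSpace {S : Subgroup G} {ρ : Representation ℂ S W} (N : Subgroup G)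
    [N.FiniteIndex] (hN : IsOpen (N : Set G)) (hNS : N ≤ S) {f : G → W}
    (hf : ∀ (h : S) (g : G), f (h * g) = ρ h (f g)) (hfN : ∀ n ∈ N, ∀ g, f (n * g) = f g) :
    -- Inverses of representatives of G/N represent N\G, so one finite set supports every such
    -- function modulo S.
    f ∈ indSpace S ρ := by
  refine ⟨hf, ?_, Set.range fun q : G ⧸ N => (q.out)⁻¹, (Set.finite_range _).isCompact, ?_⟩
  · rw [IsLocallyConstant.iff_exists_open]
    intro x
    refine ⟨(fun y => y * x⁻¹) ⁻¹' N, hN.preimage (continuous_mul_const _), by simp [N.one_mem],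
      fun y hy => ?_⟩
    have := hfN _ hy x
    simpa using this
  · intro g _
    have h : ((g⁻¹ : G) : G ⧸ N) = ((((g⁻¹ : G) : G ⧸ N).out : G) : G ⧸ N) :=
      (QuotientGroup.out_eq' _).symm
    rw [QuotientGroup.eq] at h
    exact ⟨⟨_, hNS h⟩, _, ⟨((g⁻¹ : G) : G ⧸ N), rfl⟩, by simp⟩

omit [IsTopologicalGroup G] in
theorem apply_mul_left_of_mem {S : Subgroup G} {ρ : Representation ℂ S W} {N : Subgroup G}
    (hNS : N ≤ S) (hρ : ∀ n (hn : n ∈ N), ρ ⟨n, hNS hn⟩ = 1) (f : indSpace S ρ) {n : G}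
    (hn : n ∈ N) (g : G) : f.1 (n * g) = f.1 g := by
  have := f.2.1 ⟨n, hNS hn⟩ g
  rwa [hρ n hn] at this

omit [IsTopologicalGroup G] in
-- Normality moves n to the left of g as g n g⁻¹. This is why a normal subgroup in the kernel of the
-- inducing representation acts trivially on the whole induced space.
theorem apply_mul_right_of_mem {S : Subgroup G} {ρ : Representation ℂ S W} {N : Subgroup G}
    [N.Normal] (hNS : N ≤ S) (hρ : ∀ n (hn : n ∈ N), ρ ⟨n, hNS hn⟩ = 1) (f : indSpace S ρ) {n : G}
    (hn : n ∈ N) (g : G) : f.1 (g * n) = f.1 g := by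
  have := apply_mul_left_of_mem hNS hρ f (Subgroup.Normal.conj_mem ‹_› n hn g) g
  simpa using this

omit [TopologicalSpace G] [IsTopologicalGroup G] in
theorem charRep_eq_one {S : Subgroup G} {η : S →* ℂ} {N : Subgroup G} (hNS : N ≤ S)
    (hη : ∀ n (hn : n ∈ N), η ⟨n, hNS hn⟩ = 1) (n : G) (hn : n ∈ N) :
    charRep η ⟨n, hNS hn⟩ = 1 := by
  ext; simp [charRep, hη n hn]

omit [IsTopologicalGroup G] in
theorem apply_mul_left {S : Subgroup G} {η : S →* ℂ} (f : indSpace S (charRep η)) (s : S) (g : G) :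
    f.1 (s * g) = η s * f.1 g := by
  simpa [charRep] using f.2.1 s g

theorem character_mul_inv {S : Type*} [Group S] (η : S →* ℂ) (s : S) : η s * η s⁻¹ = 1 := by
  rw [← map_mul, mul_inv_cancel, map_one]

theorem character_inv_mul {S : Type*} [Group S] (η : S →* ℂ) (s : S) : η s⁻¹ * η s = 1 := by
  rw [← map_mul, inv_mul_cancel, map_one]

open Classical in
/-- The function supported on `S` with the value `w` at the identity. -/
def extendByZero {S : Subgroup G} (ρ : Representation ℂ S W) {N : Subgroup G} [N.FiniteIndex]
    (hN : IsOpen (N : Set G)) (hNS : N ≤ S) (hρ : ∀ n (hn : n ∈ N), ρ ⟨n, hNS hn⟩ = 1) (w : W) :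
    indSpace S ρ :=
  ⟨fun g => if h : g ∈ S then ρ ⟨g, h⟩ w else 0, by
    have key : ∀ (s : S) (g : G), (if h : (s * g : G) ∈ S then ρ ⟨s * g, h⟩ w else 0)
        = ρ s (if h : g ∈ S then ρ ⟨g, h⟩ w else 0) := by
      intro s g
      by_cases hg : g ∈ S
      · rw [dif_pos hg, dif_pos (S.mul_mem s.2 hg), ← Module.End.mul_apply, ← map_mul]; rfl
      · rw [dif_neg hg, dif_neg (by rwa [S.mul_mem_cancel_left s.2]), map_zero]
    refine mem_indSpace N hN hNS key fun n hn g => ?_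
    simpa [hρ n hn] using key ⟨n, hNS hn⟩ g⟩

theorem extendByZero_of_mem {S : Subgroup G} {ρ : Representation ℂ S W} {N : Subgroup G}
    [N.FiniteIndex] (hN : IsOpen (N : Set G)) (hNS : N ≤ S)
    (hρ : ∀ n (hn : n ∈ N), ρ ⟨n, hNS hn⟩ = 1) (w : W) {g : G} (hg : g ∈ S) :
    (extendByZero ρ hN hNS hρ w).1 g = ρ ⟨g, hg⟩ w := by
  simp [extendByZero, hg]

theorem extendByZero_of_notMem {S : Subgroup G} {ρ : Representation ℂ S W} {N : Subgroup G}
    [N.FiniteIndex] (hN : IsOpen (N : Set G)) (hNS : N ≤ S)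
    (hρ : ∀ n (hn : n ∈ N), ρ ⟨n, hNS hn⟩ = 1) (w : W) {g : G} (hg : g ∉ S) :
    (extendByZero ρ hN hNS hρ w).1 g = 0 := by
  simp [extendByZero, hg]

theorem extendByZero_ne_zero {S : Subgroup G} {ρ : Representation ℂ S W} {N : Subgroup G}
    [N.FiniteIndex] (hN : IsOpen (N : Set G)) (hNS : N ≤ S)
    (hρ : ∀ n (hn : n ∈ N), ρ ⟨n, hNS hn⟩ = 1) {w : W} (hw : w ≠ 0) :
    extendByZero ρ hN hNS hρ w ≠ 0 := by
  intro h
  have h1 := extendByZero_of_mem hN hNS hρ w S.one_mem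
  rw [h] at h1
  change 0 = ρ 1 w at h1
  rw [map_one] at h1
  exact hw h1.symm

variable (S : Subgroup G) (η : S →* ℂ) (N : Subgroup G) [N.FiniteIndex]

/-- The function supported on `S` which is equal to `η` there. -/
def delta (hN : IsOpen (N : Set G)) (hNS : N ≤ S) (hη : ∀ n (hn : n ∈ N), η ⟨n, hNS hn⟩ = 1) :
    indSpace S (charRep η) :=
  extendByZero (charRep η) hN hNS (charRep_eq_one hNS hη) 1

variable {S η N}
variable (hN : IsOpen (N : Set G)) (hNS : N ≤ S) (hη : ∀ n (hn : n ∈ N), η ⟨n, hNS hn⟩ = 1)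

theorem delta_of_mem {g : G} (hg : g ∈ S) : (delta S η N hN hNS hη).1 g = η ⟨g, hg⟩ := by
  rw [delta, extendByZero_of_mem _ _ _ _ hg]
  simp [charRep]

theorem delta_of_notMem {g : G} (hg : g ∉ S) : (delta S η N hN hNS hη).1 g = 0 :=
  extendByZero_of_notMem _ _ _ _ hg

/-- The translates of `delta` span the induced space. -/
theorem eq_sum_translates [Fintype (G ⧸ S)] (f : indSpace S (charRep η)) :
    f = ∑ q : G ⧸ S, f.1 (q.out)⁻¹ • ind S (charRep η) q.out (delta S η N hN hNS hη) := by
  ext x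
  rw [AddSubmonoidClass.coe_finsetSum, Finset.sum_apply]
  rw [Finset.sum_eq_single ((x⁻¹ : G) : G ⧸ S)]
  · have h : ((x⁻¹ : G) : G ⧸ S) = ((((x⁻¹ : G) : G ⧸ S).out : G) : G ⧸ S) :=
      (QuotientGroup.out_eq' _).symm
    rw [QuotientGroup.eq, inv_inv] at h
    change _ = _ * (delta S η N hN hNS hη).1 (x * _)
    rw [delta_of_mem hN hNS hη h, mul_comm, ← apply_mul_left]
    simp
  · intro q _ hq
    change _ * (delta S η N hN hNS hη).1 (x * _) = 0
    rw [delta_of_notMem, mul_zero]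
    intro h
    apply hq
    rw [← QuotientGroup.out_eq' q, eq_comm, QuotientGroup.eq]
    simpa using h
  · simp

include hN in
/-- A Mackey type criterion: if no function supported off `S` is biequivariant, then the
representation induced from the character is irreducible. -/
theorem ind_isIrreducible [N.Normal] (hη : ∀ n (hn : n ∈ N), η ⟨n, hNS hn⟩ = 1)
    (hS : ∀ φ : G → ℂ, (∀ (s : S) g, φ (s * g) = η s * φ g) → (∀ g (s : S), φ (g * s) = η s * φ g) →
      ∀ g, g ∉ S → φ g = 0) :
    (ind S (charRep η)).IsIrreducible := by
  have hfi : S.FiniteIndex := Subgroup.finiteIndex_of_le hNS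
  let _ : Fintype (G ⧸ S) := Fintype.ofFinite _
  let _ : Fintype (S ⧸ N.subgroupOf S) := Fintype.ofFinite _
  set δ := delta S η N hN hNS hη with hδ
  have hδ0 : δ ≠ 0 := extendByZero_ne_zero _ _ _ one_ne_zero
  -- The vector δ is cyclic, so it suffices to find it in every nonzero subrepresentation.
  have htop : ∀ W : Subrepresentation (ind S (charRep η)), δ ∈ W → W = ⊤ := by
    intro W hW
    refine eq_top_iff.2 fun f _ => ?_
    rw [eq_sum_translates hN hNS hη f]
    exact W.toSubmodule.sum_mem fun q _ =>
      W.toSubmodule.smul_mem _ (W.apply_mem_toSubmodule _ hW)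
  refine { exists_pair_ne := ⟨⊥, ⊤, fun h => ?_⟩, eq_bot_or_eq_top := fun W => ?_ }
  · have : δ ∈ (⊤ : Subrepresentation (ind S (charRep η))) := Submodule.mem_top
    rw [← h] at this
    exact hδ0 ((Submodule.mem_bot ℂ).1 this)
  · by_cases hW : W = ⊥
    · exact Or.inl hW
    refine Or.inr (htop W ?_)
    obtain ⟨f, hf, hf0⟩ : ∃ f ∈ W.toSubmodule, f ≠ 0 := by
      apply Submodule.exists_mem_ne_zero_of_ne_bot
      intro h
      exact hW (Subrepresentation.toSubmodule_injective h)
    obtain ⟨x, hx⟩ : ∃ x, f.1 x ≠ 0 := by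
      by_contra! h
      exact hf0 (Subtype.ext (funext h))
    -- After this translation the value at 1 is nonzero, and the projection below only multiplies
    -- that value by the index of N in S.
    set f₁ := ind S (charRep η) x f with hf₁
    have hf₁W : f₁ ∈ W.toSubmodule := W.apply_mem_toSubmodule x hf
    have hf₁1 : f₁.1 1 ≠ 0 := by
      change f.1 (1 * x) ≠ 0
      rwa [one_mul]
    -- Up to a scalar, this is the projection to the vectors on which S acts through η. The sum over
    -- S/N makes sense because N fixes f₁ and lies in the kernel of η.
    set F := ∑ q : S ⧸ N.subgroupOf S, η (q.out)⁻¹ • ind S (charRep η) q.out f₁ with hF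
    have hFW : F ∈ W.toSubmodule := W.toSubmodule.sum_mem fun q _ =>
      W.toSubmodule.smul_mem _ (W.apply_mem_toSubmodule _ hf₁W)
    have hFx : ∀ g, F.1 g = ∑ q : S ⧸ N.subgroupOf S, η (q.out)⁻¹ * f₁.1 (g * (q.out : S)) := by
      intro g
      rw [hF, AddSubmonoidClass.coe_finsetSum, Finset.sum_apply]
      rfl
    have hFr : ∀ g (s : S), F.1 (g * s) = η s * F.1 g := by
      intro g s
      rw [hFx, hFx, ← sum_out_mul_left (N.subgroupOf S) (fun t => η t⁻¹ * f₁.1 (g * (t : S)))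
        _ s, Finset.mul_sum]
      · refine Finset.sum_congr rfl fun q _ => ?_
        rw [mul_inv_rev, map_mul, Subgroup.coe_mul, ← mul_assoc g]
        linear_combination (-η (q.out)⁻¹ * f₁.1 (g * s * (q.out : S))) * character_mul_inv η s
      · intro s n hn
        have hn' : (n : G) ∈ N := hn
        have h1 : η n⁻¹ = 1 := hη _ (N.inv_mem hn')
        rw [mul_inv_rev, map_mul, h1, one_mul, Subgroup.coe_mul, ← mul_assoc,
          apply_mul_right_of_mem hNS (charRep_eq_one hNS hη) f₁ hn']
    have hF0 := hS F.1 (fun s g => apply_mul_left F s g) hFr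
    have hF1 : F.1 1 = Fintype.card (S ⧸ N.subgroupOf S) * f₁.1 1 := by
      rw [hFx, Fintype.card, ← nsmul_eq_mul, ← Finset.sum_const]
      refine Finset.sum_congr rfl fun q _ => ?_
      have := apply_mul_left f₁ q.out 1
      rw [mul_one] at this
      rw [one_mul, this, ← mul_assoc, character_inv_mul, one_mul]
    have hF1' : F.1 1 ≠ 0 := by
      rw [hF1]
      exact mul_ne_zero (by simp) hf₁1
    -- Being biequivariant, F vanishes off S, and on S it is determined by its value at 1.
    have : δ = (F.1 1)⁻¹ • F := by
      ext g
      change _ = (F.1 1)⁻¹ * F.1 g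
      by_cases hg : g ∈ S
      · rw [hδ, delta_of_mem hN hNS hη hg]
        have := apply_mul_left F ⟨g, hg⟩ 1
        rw [mul_one] at this
        rw [this]
        field_simp
      · rw [hF0 g hg, hδ, delta_of_notMem hN hNS hη hg, mul_zero]
    rw [this]
    exact W.toSubmodule.smul_mem _ hFW

end FiniteLevel

/-! ### Intertwining maps obtained by averaging -/

section Averaging

variable {G : Type*} [Group G] [TopologicalSpace G] [IsTopologicalGroup G]
variable {S : Subgroup G} {η : S →* ℂ} {S' : Subgroup G} {χ : S' →* ℂ}
variable {N : Subgroup G} [N.FiniteIndex] [N.Normal]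
variable (hN : IsOpen (N : Set G)) (hNS : N ≤ S) (hη : ∀ n (hn : n ∈ N), η ⟨n, hNS hn⟩ = 1)
variable (hNS' : N ≤ S') (hχ : ∀ n (hn : n ∈ N), χ ⟨n, hNS' hn⟩ = 1)

open Classical in
/-- The intertwining map between induced representations given by averaging on the left. -/
def average : (ind S (charRep η)).IntertwiningMap (ind S' (charRep χ)) :=
  letI : Fintype (S' ⧸ N.subgroupOf S') := Fintype.ofFinite _
  LinearMap.intertwiningMap_of_isIntertwiningMap _ _
    { toFun := fun f => ⟨fun g => ∑ q : S' ⧸ N.subgroupOf S', χ q.out * f.1 (((q.out : S') : G)⁻¹ * g), by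
        have key : ∀ (s : S') (g : G),
            ∑ q : S' ⧸ N.subgroupOf S', χ q.out * f.1 (((q.out : S') : G)⁻¹ * (s * g)) =
            χ s * ∑ q : S' ⧸ N.subgroupOf S', χ q.out * f.1 (((q.out : S') : G)⁻¹ * g) := by
          intro s g
          rw [← sum_out_mul_left (N.subgroupOf S') (fun t => χ t * f.1 ((t : G)⁻¹ * g)) _ s⁻¹,
            Finset.mul_sum]
          · refine Finset.sum_congr rfl fun q _ => ?_
            rw [map_mul, Subgroup.coe_mul, mul_inv_rev, Subgroup.coe_inv, inv_inv,
              mul_assoc (_ : G) _ g]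
            linear_combination
              (-χ q.out * f.1 (((q.out : S') : G)⁻¹ * (s * g))) * character_mul_inv χ s
          · intro s n hn
            have hn' : (n : G) ∈ N := hn
            have h1 : χ n = 1 := hχ _ hn'
            rw [map_mul, h1, mul_one, Subgroup.coe_mul, mul_inv_rev, mul_assoc,
              apply_mul_left_of_mem hNS (charRep_eq_one hNS hη) f (N.inv_mem hn')]
        refine mem_indSpace N hN hNS' (fun s g => by simpa [charRep, Finset.mul_sum] using key s g)
          fun n hn g => ?_
        simpa [hχ n hn] using key ⟨n, hNS' hn⟩ g⟩
      map_add' := fun f₁ f₂ => by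
        ext g
        simp [mul_add, Finset.sum_add_distrib]
      map_smul' := fun a f => by
        ext g
        simp only [SetLike.val_smul, Pi.smul_apply, smul_eq_mul, RingHom.id_apply, Finset.mul_sum]
        exact Finset.sum_congr rfl fun q _ => by ring }
    (fun x f => by
      ext g
      simp [ind, mul_assoc])

omit [N.Normal] in
-- Applied to `delta` and evaluated at 1, the average counts the classes of S'/N contained in S.
-- Agreement on S ∩ S' makes each such term equal to 1, so nothing cancels, and the trivial class
-- contributes.
theorem average_ne_zero (h : ∀ g (hg : g ∈ S) (hg' : g ∈ S'), η ⟨g, hg⟩ = χ ⟨g, hg'⟩) :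
    average hN hNS hη hNS' hχ ≠ 0 := by
  classical
  let _ : Fintype (S' ⧸ N.subgroupOf S') := Fintype.ofFinite _
  intro h0
  have h1 : (average hN hNS hη hNS' hχ (delta S η N hN hNS hη)).1 1 = 0 := by rw [h0]; rfl
  have h2 : ∑ q : S' ⧸ N.subgroupOf S',
      χ q.out * (delta S η N hN hNS hη).1 (((q.out : S') : G)⁻¹ * 1) = 0 := h1
  have h3 : ∀ s : S', χ s * (delta S η N hN hNS hη).1 ((s : G)⁻¹ * 1)
      = if (s : G) ∈ S then 1 else 0 := by
    intro s
    rw [mul_one]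
    by_cases hs : (s : G) ∈ S
    · rw [if_pos hs, delta_of_mem hN hNS hη (S.inv_mem hs), h _ _ (S'.inv_mem s.2)]
      exact character_mul_inv χ s
    · rw [if_neg hs, delta_of_notMem hN hNS hη (by simpa using hs), mul_zero]
  simp only [h3] at h2
  rw [Finset.sum_boole, Nat.cast_eq_zero, Finset.card_eq_zero,
    Finset.filter_eq_empty_iff] at h2
  refine h2 (Finset.mem_univ ((1 : S') : S' ⧸ N.subgroupOf S')) ?_
  have e : ((1 : S') : S' ⧸ N.subgroupOf S')
      = ((((1 : S') : S' ⧸ N.subgroupOf S').out : S') : S' ⧸ N.subgroupOf S') :=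
    (QuotientGroup.out_eq' _).symm
  rw [QuotientGroup.eq, inv_one, one_mul] at e
  exact hNS e

end Averaging

/-! ### Whittaker functionals of cuspidal representations over a finite field -/

section Whittaker

variable {k : Type*} [Field k]

theorem coe_unip (x : k) : (unip x).1 = !![1, x; 0, 1] := rfl

theorem unip_mul (x y : k) : unip x * unip y = unip (x + y) := by
  apply Units.ext
  rw [Units.val_mul, coe_unip, coe_unip, coe_unip]
  simp [add_comm]

theorem unip_zero : unip (0 : k) = 1 := by
  apply Units.ext
  rw [coe_unip]
  simp [Matrix.one_fin_two]

theorem det_ne_zero_fin_two (g : GL (Fin 2) k) : g 0 0 * g 1 1 - g 0 1 * g 1 0 ≠ 0 := by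
  rw [← Matrix.det_fin_two]
  exact g.det_ne_zero

/-- Reflection of a matrix in the antidiagonal. -/
def antiTranspose (g : GL (Fin 2) k) : GL (Fin 2) k :=
  Matrix.GeneralLinearGroup.mkOfDetNeZero !![g 1 1, g 0 1; g 1 0, g 0 0] (by
    rw [Matrix.det_fin_two_of, mul_comm]; exact det_ne_zero_fin_two g)

theorem coe_antiTranspose (g : GL (Fin 2) k) :
    (antiTranspose g).1 = !![g 1 1, g 0 1; g 1 0, g 0 0] := rfl

/-- `antiTranspose` as an antihomomorphism. -/
def antiTransposeHom : GL (Fin 2) k →* (GL (Fin 2) k)ᵐᵒᵖ where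
  toFun g := MulOpposite.op (antiTranspose g)
  map_one' := by
    apply MulOpposite.unop_injective
    apply Units.ext
    simp [coe_antiTranspose, Matrix.one_fin_two]
  map_mul' g h := by
    apply MulOpposite.unop_injective
    apply Units.ext
    rw [MulOpposite.unop_mul, MulOpposite.unop_op, MulOpposite.unop_op, MulOpposite.unop_op,
      Units.val_mul, coe_antiTranspose, coe_antiTranspose, coe_antiTranspose]
    ext i j
    fin_cases i <;> fin_cases j <;> simp [Matrix.mul_apply, Fin.sum_univ_two] <;> ring

theorem antiTranspose_unip (x : k) : antiTranspose (unip x) = unip x := by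
  apply Units.ext
  rw [coe_antiTranspose, coe_unip]
  simp

/-- The antiautomorphism of the group algebra induced by `antiTranspose`. -/
def antiInvolution : MonoidAlgebra ℂ (GL (Fin 2) k) →ₐ[ℂ] (MonoidAlgebra ℂ (GL (Fin 2) k))ᵐᵒᵖ :=
  MonoidAlgebra.lift ℂ _ _ ((MonoidAlgebra.of ℂ (GL (Fin 2) k)).op.comp antiTransposeHom)

theorem antiInvolution_of (g : GL (Fin 2) k) :
    antiInvolution (MonoidAlgebra.of ℂ _ g) =
      MulOpposite.op (MonoidAlgebra.of ℂ _ (antiTranspose g)) := by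
  rw [antiInvolution, MonoidAlgebra.lift_of]
  rfl

variable [Fintype k] (θ : AddChar k ℂ)

/-- The idempotent of the group algebra attached to a character of the unipotent radical. -/
def whittakerIdem : MonoidAlgebra ℂ (GL (Fin 2) k) :=
  (Fintype.card k : ℂ)⁻¹ • ∑ x : k, θ (-x) • MonoidAlgebra.of ℂ _ (unip x)

omit [Fintype k] in
theorem addChar_neg_mul (x : k) : θ (-x) * θ x = 1 := by
  rw [← AddChar.map_add_eq_mul, neg_add_cancel, AddChar.map_zero_eq_one]

theorem of_unip_mul_whittakerIdem (x : k) :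
    MonoidAlgebra.of ℂ _ (unip x) * whittakerIdem θ = θ x • whittakerIdem θ := by
  rw [whittakerIdem, mul_smul_comm, smul_comm (θ x), Finset.mul_sum]
  congr 1
  rw [Finset.smul_sum]
  apply Fintype.sum_equiv (Equiv.addLeft x)
  intro y
  rw [mul_smul_comm, ← map_mul, unip_mul, smul_smul, ← AddChar.map_add_eq_mul, Equiv.coe_addLeft]
  congr 2
  ring

theorem whittakerIdem_mul_of_unip (x : k) :
    whittakerIdem θ * MonoidAlgebra.of ℂ _ (unip x) = θ x • whittakerIdem θ := by
  rw [whittakerIdem, smul_mul_assoc, smul_comm (θ x), Finset.sum_mul]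
  congr 1
  rw [Finset.smul_sum]
  apply Fintype.sum_equiv (Equiv.addRight x)
  intro y
  rw [smul_mul_assoc, ← map_mul, unip_mul, smul_smul, ← AddChar.map_add_eq_mul,
    Equiv.coe_addRight]
  congr 2
  ring

theorem whittakerIdem_mul_self : whittakerIdem θ * whittakerIdem θ = whittakerIdem θ := by
  conv_lhs => enter [1]; rw [whittakerIdem]
  rw [smul_mul_assoc, Finset.sum_mul]
  have : ∀ x : k, θ (-x) • MonoidAlgebra.of ℂ _ (unip x) * whittakerIdem θ = whittakerIdem θ := by
    intro x
    rw [smul_mul_assoc, of_unip_mul_whittakerIdem, smul_smul, addChar_neg_mul, one_smul]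
  rw [Finset.sum_congr rfl fun x _ => this x, Finset.sum_const, Finset.card_univ,
    ← Nat.cast_smul_eq_nsmul ℂ, smul_smul, inv_mul_cancel₀ (by simp), one_smul]

theorem antiInvolution_whittakerIdem :
    antiInvolution (whittakerIdem θ) = MulOpposite.op (whittakerIdem θ) := by
  simp only [whittakerIdem, map_smul, map_sum, antiInvolution_of, antiTranspose_unip,
    MulOpposite.op_smul, Finset.op_sum]

variable {θ}

/-- Conjugation by g rescales U by a ratio different from 1. A nonzero product would force θ to be
invariant under this rescaling, which a nontrivial θ is not. -/
theorem whittakerIdem_mul_of_mul_eq_zero (hθ : θ ≠ 1) {g : GL (Fin 2) k} (h10 : g 1 0 = 0)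
    (hne : g 0 0 ≠ g 1 1) :
    whittakerIdem θ * MonoidAlgebra.of ℂ _ g * whittakerIdem θ = 0 := by
  have hdet := det_ne_zero_fin_two g
  rw [h10, mul_zero, sub_zero] at hdet
  have h0 : g 0 0 ≠ 0 := left_ne_zero_of_mul hdet
  have h1 : g 1 1 ≠ 0 := right_ne_zero_of_mul hdet
  obtain ⟨z, hz⟩ : ∃ z, θ z ≠ 1 := by
    by_contra! h
    exact hθ (by ext x; simp [h x])
  -- Solves y - y g₁₁ / g₀₀ = z in 0-based indices, so that the two eigenvalues differ by the factor
  -- θ z ≠ 1.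
  set y := z * (g 0 0) / (g 0 0 - g 1 1) with hy
  have hsub : g 0 0 - g 1 1 ≠ 0 := sub_ne_zero.2 hne
  have hcomm : unip y * g = g * unip (y * g 1 1 / g 0 0) := by
    apply Units.ext
    rw [Units.val_mul, Units.val_mul, coe_unip, coe_unip]
    ext i j
    fin_cases i <;> fin_cases j <;>
      simp [Matrix.mul_apply, Fin.sum_univ_two, h10]
    field_simp
    ring
  have h2 : θ y • (whittakerIdem θ * MonoidAlgebra.of ℂ _ g * whittakerIdem θ)
      = θ (y * g 1 1 / g 0 0) •
        (whittakerIdem θ * MonoidAlgebra.of ℂ _ g * whittakerIdem θ) := by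
    rw [← smul_mul_assoc, ← smul_mul_assoc, ← whittakerIdem_mul_of_unip, mul_assoc _ _
      (MonoidAlgebra.of ℂ _ g), ← map_mul, hcomm, map_mul, mul_assoc, mul_assoc,
      of_unip_mul_whittakerIdem, mul_smul_comm, mul_smul_comm, mul_assoc]
  have h3 : θ y = θ z * θ (y * g 1 1 / g 0 0) := by
    rw [← AddChar.map_add_eq_mul]
    congr 1
    rw [hy]
    field_simp
    ring
  rw [h3, ← sub_eq_zero, ← sub_smul, smul_eq_zero] at h2
  refine h2.resolve_left fun h => ?_
  have h4 : θ (y * g 1 1 / g 0 0) ≠ 0 := fun h' => by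
    have := addChar_neg_mul θ (y * g 1 1 / g 0 0)
    rw [h', mul_zero] at this
    exact zero_ne_one this
  apply hz
  apply mul_right_cancel₀ h4
  linear_combination h

/-- By the Bruhat decomposition, each double coset of U either has a representative fixed by
`antiTranspose` (antidiagonal, or upper triangular with equal diagonal entries) or contributes zero.
-/
theorem antiInvolution_sandwich_of (hθ : θ ≠ 1) (g : GL (Fin 2) k) :
    antiInvolution (whittakerIdem θ * MonoidAlgebra.of ℂ _ g * whittakerIdem θ) =
      MulOpposite.op (whittakerIdem θ * MonoidAlgebra.of ℂ _ g * whittakerIdem θ) := by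
  have base : ∀ g : GL (Fin 2) k, antiTranspose g = g →
      antiInvolution (whittakerIdem θ * MonoidAlgebra.of ℂ _ g * whittakerIdem θ) =
      MulOpposite.op (whittakerIdem θ * MonoidAlgebra.of ℂ _ g * whittakerIdem θ) := by
    intro g hg
    rw [map_mul, map_mul, antiInvolution_whittakerIdem, antiInvolution_of, hg,
      ← MulOpposite.op_mul, ← MulOpposite.op_mul, mul_assoc]
  by_cases h10 : g 1 0 = 0
  · by_cases hne : g 0 0 = g 1 1
    · apply base
      apply Units.ext
      rw [coe_antiTranspose]
      ext i j
      fin_cases i <;> fin_cases j <;> simp [hne]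
    · rw [whittakerIdem_mul_of_mul_eq_zero hθ h10 hne, map_zero, MulOpposite.op_zero]
  · have hdet := det_ne_zero_fin_two g
    -- The upper right entry is -det g / g₁₀ in 0-based indices: this is the antidiagonal Bruhat
    -- representative.
    have hw : Matrix.det !![0, g 0 1 - g 0 0 * g 1 1 / g 1 0; g 1 0, 0] ≠ 0 := by
      rw [Matrix.det_fin_two_of]
      intro h
      apply hdet
      field_simp at h
      linear_combination h
    set w := Matrix.GeneralLinearGroup.mkOfDetNeZero _ hw with hwdef
    have hwc : w.1 = !![0, g 0 1 - g 0 0 * g 1 1 / g 1 0; g 1 0, 0] := rfl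
    have hg : g = unip (g 0 0 / g 1 0) * w * unip (g 1 1 / g 1 0) := by
      apply Units.ext
      rw [Units.val_mul, Units.val_mul, coe_unip, coe_unip, hwc]
      ext i j
      fin_cases i <;> fin_cases j <;> simp [Matrix.mul_apply, Fin.sum_univ_two] <;> field_simp
      ring
    have hwt : antiTranspose w = w := by
      apply Units.ext
      rw [coe_antiTranspose, hwc]
      ext i j
      fin_cases i <;> fin_cases j <;> simp
    have e : whittakerIdem θ * MonoidAlgebra.of ℂ _ g * whittakerIdem θ =
        (θ (g 0 0 / g 1 0) * θ (g 1 1 / g 1 0)) •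
          (whittakerIdem θ * MonoidAlgebra.of ℂ _ w * whittakerIdem θ) := by
      conv_lhs => rw [hg]
      rw [map_mul, map_mul, ← mul_assoc, ← mul_assoc, whittakerIdem_mul_of_unip, mul_assoc,
        of_unip_mul_whittakerIdem, mul_smul_comm, smul_mul_assoc, smul_mul_assoc, smul_smul,
        mul_comm (θ _)]
    rw [e, map_smul, base w hwt, MulOpposite.op_smul]

theorem antiInvolution_sandwich (hθ : θ ≠ 1) (X : MonoidAlgebra ℂ (GL (Fin 2) k)) :
    antiInvolution (whittakerIdem θ * X * whittakerIdem θ) =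
      MulOpposite.op (whittakerIdem θ * X * whittakerIdem θ) := by
  induction X using MonoidAlgebra.induction_linear with
  | zero => simp
  | add x y hx hy => rw [mul_add, add_mul, map_add, hx, hy, MulOpposite.op_add]
  | single g a =>
    have : MonoidAlgebra.single g a = a • MonoidAlgebra.of ℂ _ g := by simp
    rw [this, mul_smul_comm, smul_mul_assoc, map_smul, antiInvolution_sandwich_of hθ,
      MulOpposite.op_smul]

/-- The Hecke algebra of a nondegenerate character of the unipotent radical is commutative. -/
theorem sandwich_comm (hθ : θ ≠ 1) (X Y : MonoidAlgebra ℂ (GL (Fin 2) k)) :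
    (whittakerIdem θ * X * whittakerIdem θ) * (whittakerIdem θ * Y * whittakerIdem θ) =
    (whittakerIdem θ * Y * whittakerIdem θ) * (whittakerIdem θ * X * whittakerIdem θ) := by
  -- Gelfand's trick: the product is again a sandwich, hence fixed by an antiautomorphism that fixes
  -- both factors and reverses their order.
  have e : (whittakerIdem θ * X * whittakerIdem θ) * (whittakerIdem θ * Y * whittakerIdem θ) =
      whittakerIdem θ * (X * whittakerIdem θ * whittakerIdem θ * Y) * whittakerIdem θ := by
    simp only [mul_assoc]
  have h := antiInvolution_sandwich hθ (X * whittakerIdem θ * whittakerIdem θ * Y)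
  rw [← e, map_mul, antiInvolution_sandwich hθ, antiInvolution_sandwich hθ,
    ← MulOpposite.op_mul] at h
  exact (MulOpposite.op_injective h).symm

variable {V : Type*} [AddCommGroup V] [Module ℂ V] (σ : Representation ℂ (GL (Fin 2) k) V)

theorem asAlgebraHom_whittakerIdem_apply (v : V) : σ.asAlgebraHom (whittakerIdem θ) v =
    (Fintype.card k : ℂ)⁻¹ • ∑ x : k, θ (-x) • σ (unip x) v := by
  simp only [whittakerIdem, map_smul, map_sum, Representation.asAlgebraHom_of,
    LinearMap.smul_apply, LinearMap.sum_apply]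

theorem whittakerIdem_apply_unip (x : k) (v : V) :
    σ.asAlgebraHom (whittakerIdem θ) (σ (unip x) v) =
      θ x • σ.asAlgebraHom (whittakerIdem θ) v := by
  rw [← Representation.asAlgebraHom_of σ (unip x), ← Module.End.mul_apply, ← map_mul,
    whittakerIdem_mul_of_unip, map_smul, LinearMap.smul_apply]

/-- Fourier inversion for x ↦ σ(unip x) v. The coefficient at 0 is fixed by U, hence zero. The
coefficient at a ≠ 0 is carried by diag(a, 1) to a multiple of the θ-projection of a Borel translate
of v, hence zero too. The sum of all coefficients is |k| v. -/
theorem eq_zero_of_whittakerIdem (hθ : θ ≠ 1)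
    (hfix : ∀ v : V, (∀ x : k, σ (unip x) v = v) → v = 0) {v : V}
    (hv : ∀ g : GL (Fin 2) k, g 1 0 = 0 → σ.asAlgebraHom (whittakerIdem θ) (σ g v) = 0) :
    v = 0 := by
  classical
  have hq : (Fintype.card k : ℂ) ≠ 0 := by simp
  set s : k → V := fun a => ∑ x : k, θ (-(a * x)) • σ (unip x) v with hs
  have hs0 : ∀ a, a ≠ 0 → s a = 0 := by
    intro a ha
    have hd : Matrix.det !![a, 0; 0, 1] ≠ 0 := by simpa using ha
    set d := Matrix.GeneralLinearGroup.mkOfDetNeZero _ hd with hd'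
    have hdc : d.1 = !![a, 0; 0, 1] := rfl
    have h1 := hv d (by rw [hdc]; simp)
    have hcomm : ∀ x, unip (a * x) * d = d * unip x := by
      intro x
      apply Units.ext
      rw [Units.val_mul, Units.val_mul, coe_unip, coe_unip, hdc]
      simp
    have h2 : σ.asAlgebraHom (whittakerIdem θ) (σ d v) = (Fintype.card k : ℂ)⁻¹ • σ d (s a) := by
      rw [asAlgebraHom_whittakerIdem_apply, hs, map_sum]
      congr 1
      symm
      apply Fintype.sum_equiv (Equiv.mulLeft₀ a ha)
      intro x
      rw [map_smul, ← Module.End.mul_apply, ← map_mul, ← hcomm, map_mul, Module.End.mul_apply,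
        Equiv.mulLeft₀_apply]
    rw [h1, eq_comm, smul_eq_zero] at h2
    have h3 := h2.resolve_left (inv_ne_zero hq)
    have h4 := congrArg (σ d⁻¹) h3
    rwa [map_zero, ← Module.End.mul_apply, ← map_mul, inv_mul_cancel, map_one,
      Module.End.one_apply] at h4
  have hs1 : s 0 = 0 := by
    apply hfix
    intro x
    rw [hs, map_sum]
    apply Fintype.sum_equiv (Equiv.addLeft x)
    intro y
    rw [zero_mul, zero_mul, map_smul, ← Module.End.mul_apply, ← map_mul, unip_mul,
      Equiv.coe_addLeft]
  have hsum : ∑ a, s a = (Fintype.card k : ℂ) • v := by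
    simp only [hs]
    rw [Finset.sum_comm]
    have : ∀ x : k, ∑ a : k, θ (-(a * x)) • σ (unip x) v =
        if x = 0 then (Fintype.card k : ℂ) • v else 0 := by
      intro x
      have h := AddChar.sum_mulShift (-x) (AddChar.IsPrimitive.of_ne_one hθ)
      simp only [mul_neg] at h
      rw [← Finset.sum_smul, h]
      by_cases hx : x = 0
      · simp [hx, unip_zero]
      · simp [hx]
    rw [Finset.sum_congr rfl fun x _ => this x]
    simp
  rw [Finset.sum_eq_zero fun a _ => ?_, eq_comm, smul_eq_zero] at hsum
  · exact hsum.resolve_left hq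
  · by_cases ha : a = 0
    · rw [ha, hs1]
    · exact hs0 a ha

omit [Fintype k] in
theorem exists_asAlgebraHom_apply_eq [σ.IsIrreducible] {v : V} (hv : v ≠ 0) (w : V) :
    ∃ X, σ.asAlgebraHom X v = w := by
  let R : Subrepresentation σ :=
    { toSubmodule := LinearMap.range ((LinearMap.applyₗ v).comp σ.asAlgebraHom.toLinearMap)
      apply_mem_toSubmodule := by
        rintro g _ ⟨X, rfl⟩
        refine ⟨MonoidAlgebra.of ℂ _ g * X, ?_⟩
        simp }
  have hvR : v ∈ R.toSubmodule := ⟨1, by simp⟩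
  have hR : R = ⊤ := by
    refine (eq_bot_or_eq_top R).resolve_left fun h => hv ?_
    rw [h] at hvR
    exact (Submodule.mem_bot ℂ).1 hvR
  have hw : w ∈ R.toSubmodule := by rw [hR]; exact Submodule.mem_top
  obtain ⟨X, hX⟩ := hw
  exact ⟨X, hX⟩

/-- The group is finite and the orbit of any nonzero vector spans. Finite dimension supplies the
eigenvalue in Schur's lemma below. -/
theorem finiteDimensional_of_isIrreducible [hσ : σ.IsIrreducible] : FiniteDimensional ℂ V := by
  by_cases h : ∃ v : V, v ≠ 0
  · obtain ⟨v, hv⟩ := h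
    have : Finite (GL (Fin 2) k) := inferInstance
    refine Module.Finite.of_fg_top ?_
    rw [Submodule.fg_def]
    refine ⟨Set.range fun g => σ g v, Set.finite_range _, eq_top_iff.2 fun w _ => ?_⟩
    obtain ⟨X, rfl⟩ := exists_asAlgebraHom_apply_eq σ hv w
    induction X using MonoidAlgebra.induction_linear with
    | zero => simp
    | add x y hx hy => rw [map_add, LinearMap.add_apply]; exact add_mem (hx trivial) (hy trivial)
    | single g a =>
      rw [Representation.asAlgebraHom_single, LinearMap.smul_apply]
      exact Submodule.smul_mem _ _ (Submodule.subset_span ⟨g, rfl⟩)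
  · have : Subsingleton V := ⟨fun a b => by push Not at h; rw [h a, h b]⟩
    infer_instance

/-- Schur's lemma for the Hecke algebra acting on the space of Whittaker vectors. -/
theorem exists_scalar_sandwich (hθ : θ ≠ 1) [σ.IsIrreducible]
    (X : MonoidAlgebra ℂ (GL (Fin 2) k)) :
    ∃ c : ℂ, ∀ v, σ.asAlgebraHom (whittakerIdem θ) v = v →
      σ.asAlgebraHom (whittakerIdem θ * X * whittakerIdem θ) v = c • v := by
  set E := σ.asAlgebraHom (whittakerIdem θ) with hE
  have hEE : ∀ v, E (E v) = E v := fun v => by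
    rw [← Module.End.mul_apply, hE, ← map_mul, whittakerIdem_mul_self]
  set T := σ.asAlgebraHom (whittakerIdem θ * X * whittakerIdem θ) with hT
  have hTE : ∀ v, E (T v) = T v := fun v => by
    rw [← Module.End.mul_apply, hE, hT, ← map_mul, ← mul_assoc, ← mul_assoc,
      whittakerIdem_mul_self]
  by_cases h0 : ∃ v, v ≠ 0 ∧ E v = v
  swap
  · refine ⟨0, fun v hv => ?_⟩
    have : v = 0 := by
      by_contra h
      exact h0 ⟨v, h, hv⟩
    rw [this, map_zero, smul_zero]
  obtain ⟨v₀, hv₀, hEv₀⟩ := h0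
  have := finiteDimensional_of_isIrreducible σ
  let P : Submodule ℂ V := LinearMap.range E
  have hP : ∀ v ∈ P, E v = v := by
    rintro _ ⟨w, rfl⟩
    exact hEE w
  have hTP : ∀ v ∈ P, T v ∈ P := fun v _ => ⟨T v, hTE v⟩
  have : Nontrivial P := ⟨⟨⟨v₀, v₀, hEv₀⟩, 0, fun h => hv₀ (congrArg Subtype.val h)⟩⟩
  obtain ⟨c, hc⟩ := Module.End.exists_eigenvalue (T.restrict hTP)
  obtain ⟨u, hu⟩ := hc.exists_hasEigenvector
  have hu0 : (u : V) ≠ 0 := fun h => hu.2 (Subtype.ext h)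
  have huc : T u = c • (u : V) := congrArg Subtype.val hu.apply_eq_smul
  refine ⟨c, fun v hv => ?_⟩
  -- The Hecke algebra carries the eigenvector u to any Whittaker vector v and commutes with T, so v
  -- has the same eigenvalue.
  obtain ⟨Y, hY⟩ := exists_asAlgebraHom_apply_eq σ hu0 v
  have hY' : σ.asAlgebraHom (whittakerIdem θ * Y * whittakerIdem θ) u = v := by
    rw [map_mul, map_mul, Module.End.mul_apply, Module.End.mul_apply, ← hE, hP _ u.2, hY, hv]
  rw [← hY', ← Module.End.mul_apply, hT, ← map_mul, sandwich_comm hθ, map_mul,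
    Module.End.mul_apply, ← hT, huc, map_smul]

/-- A cuspidal representation has a nonzero Whittaker functional, and its translates under
the Borel subgroup separate vectors. -/
theorem IsCuspidal.exists_whittaker {σ : Representation ℂ (GL (Fin 2) k) V} (hσ : IsCuspidal σ)
    (hθ : θ ≠ 1) :
    ∃ (v₀ : V) (L : V →ₗ[ℂ] ℂ), L v₀ = 1 ∧
      (∀ x v, L (σ (unip x) v) = θ x * L v) ∧
      ∀ v, (∀ g : GL (Fin 2) k, g 1 0 = 0 → L (σ g v) = 0) → v = 0 := by
  have := hσ.1
  set E := σ.asAlgebraHom (whittakerIdem θ) with hE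
  have hEE : ∀ v, E (E v) = E v := fun v => by
    rw [← Module.End.mul_apply, hE, ← map_mul, whittakerIdem_mul_self]
  obtain ⟨w, hw⟩ : ∃ w : V, w ≠ 0 := by
    by_contra! h
    obtain ⟨A, B, hAB⟩ := exists_pair_ne (Subrepresentation σ)
    refine hAB (Subrepresentation.toSubmodule_injective (Submodule.ext fun x => ?_))
    simp [h x]
  obtain ⟨v₀, hv₀, hEv₀⟩ : ∃ v₀, v₀ ≠ 0 ∧ E v₀ = v₀ := by
    by_contra! h
    refine hw (eq_zero_of_whittakerIdem σ hθ hσ.2 fun g _ => ?_)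
    by_contra h'
    exact h _ h' (hEE _)
  obtain ⟨μ, hμ⟩ := Module.Projective.exists_dual_eq_one ℂ hv₀
  -- Multiplicity one: E has rank one, so the single functional μ ∘ E vanishes exactly where E does.
  have hEs : ∀ v, ∃ c : ℂ, E v = c • v₀ := by
    intro v
    obtain ⟨X, hX⟩ := exists_asAlgebraHom_apply_eq σ hv₀ v
    obtain ⟨c, hc⟩ := exists_scalar_sandwich σ hθ X
    refine ⟨c, ?_⟩
    rw [← hc v₀ hEv₀, map_mul, map_mul, Module.End.mul_apply, Module.End.mul_apply, ← hE, hEv₀, hX]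
  refine ⟨v₀, μ.comp E, ?_, fun x v => ?_, fun v hv => ?_⟩
  · rw [LinearMap.comp_apply, hEv₀, hμ]
  · rw [LinearMap.comp_apply, hE, whittakerIdem_apply_unip, map_smul, smul_eq_mul]
    rfl
  · refine eq_zero_of_whittakerIdem σ hθ hσ.2 fun g hg => ?_
    obtain ⟨c, hc⟩ := hEs (σ g v)
    have := hv g hg
    rw [LinearMap.comp_apply, hc, map_smul, hμ, smul_eq_mul, mul_one] at this
    rw [← hE, hc, this, zero_smul]

end Whittaker

/-! ### Elementary matrices over a commutative ring -/

section Elementary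

variable {A : Type*} [CommRing A]

/-- The matrix `[1 x; 0 1]` over a commutative ring. -/
def upperUnip (x : A) : GL (Fin 2) A :=
  Matrix.GeneralLinearGroup.mk'' !![1, x; 0, 1] (by simp)

/-- The matrix `[1 0; y 1]` over a commutative ring. -/
def lowerUnip (y : A) : GL (Fin 2) A :=
  Matrix.GeneralLinearGroup.mk'' !![1, 0; y, 1] (by simp)

/-- The matrix `[a x; 0 d]` with units on the diagonal. -/
def upperTri (a d : Aˣ) (x : A) : GL (Fin 2) A :=
  Matrix.GeneralLinearGroup.mk'' !![(a : A), x; 0, (d : A)] (by simp)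

theorem coe_upperUnip (x : A) : (upperUnip x).1 = !![1, x; 0, 1] := rfl

theorem coe_lowerUnip (x : A) : (lowerUnip x).1 = !![1, 0; x, 1] := rfl

theorem coe_upperTri (a d : Aˣ) (x : A) : (upperTri a d x).1 = !![(a : A), x; 0, (d : A)] := rfl

theorem isUnit_det_fin_two (g : GL (Fin 2) A) : IsUnit (g 0 0 * g 1 1 - g 0 1 * g 1 0) := by
  rw [← Matrix.det_fin_two]
  exact (Matrix.isUnit_iff_isUnit_det _).1 g.isUnit

theorem isUnit_diag_of_mem_maximalIdeal [IsLocalRing A] {g : GL (Fin 2) A}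
    (h : g 0 1 ∈ IsLocalRing.maximalIdeal A) : IsUnit (g 0 0) ∧ IsUnit (g 1 1) := by
  have hd := isUnit_det_fin_two g
  constructor
  · by_contra hn
    exact (IsLocalRing.mem_maximalIdeal _).1 (sub_mem (Ideal.mul_mem_right _ _
      ((IsLocalRing.mem_maximalIdeal _).2 hn)) (Ideal.mul_mem_right _ _ h)) hd
  · by_contra hn
    exact (IsLocalRing.mem_maximalIdeal _).1 (sub_mem (Ideal.mul_mem_left _ _
      ((IsLocalRing.mem_maximalIdeal _).2 hn)) (Ideal.mul_mem_right _ _ h)) hd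

end Elementary

/-! ### Congruence subgroups and divisibility in the ring of integers -/

section Local

variable {F : Type*} [Field F] [ValuativeRel F] [TopologicalSpace F]
  [IsNonarchimedeanLocalField F]

instance congrSub_normal (n : ℕ) : (congrSub F n).Normal := by
  unfold congrSub; infer_instance

instance congrSub_finiteIndex (n : ℕ) : (congrSub F n).FiniteIndex := by
  have : Finite (𝒪[F] ⧸ 𝓂[F]) := inferInstanceAs (Finite 𝓀[F])
  have : Finite (𝒪[F] ⧸ 𝓂[F] ^ n) := Ideal.finite_quotient_pow (IsNoetherian.noetherian _) n
  have : Finite (GL (Fin 2) (𝒪[F] ⧸ 𝓂[F] ^ n)) := inferInstance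
  unfold congrSub
  exact Subgroup.finiteIndex_ker _

theorem mem_congrSub {n : ℕ} {g : GL (Fin 2) 𝒪[F]} :
    g ∈ congrSub F n ↔ ∀ i j, g i j - (1 : Matrix (Fin 2) (Fin 2) 𝒪[F]) i j ∈ 𝓂[F] ^ n := by
  rw [congrSub, MonoidHom.mem_ker, Matrix.GeneralLinearGroup.ext_iff]
  refine forall₂_congr fun i j => ?_
  rw [Matrix.GeneralLinearGroup.map_apply, ← Ideal.Quotient.eq]
  fin_cases i <;> fin_cases j <;> simp

theorem isOpen_congrSub (n : ℕ) : IsOpen (congrSub F n : Set (GL (Fin 2) 𝒪[F])) := by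
  have e : (congrSub F n : Set (GL (Fin 2) 𝒪[F])) = ⋂ i, ⋂ j, (fun g : GL (Fin 2) 𝒪[F] =>
      g i j - (1 : Matrix (Fin 2) (Fin 2) 𝒪[F]) i j) ⁻¹' ((𝓂[F] ^ n : Ideal 𝒪[F]) : Set 𝒪[F]) := by
    ext g
    simp only [SetLike.mem_coe, mem_congrSub, Set.mem_iInter, Set.mem_preimage]
  have : T2Space F := by
    let := IsTopologicalAddGroup.rightUniformSpace F
    have := isUniformAddGroup_of_addCommGroup (G := F)
    infer_instance
  rw [e]
  refine isOpen_iInter_of_finite fun i => isOpen_iInter_of_finite fun j => ?_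
  exact (IsLocalRing.isOpen_maximalIdeal_pow _ n).preimage
    ((Units.continuous_val.matrix_elem i j).sub continuous_const)

theorem congrSub_antitone {m n : ℕ} (h : m ≤ n) : congrSub F n ≤ congrSub F m := by
  intro g hg
  rw [mem_congrSub] at *
  exact fun i j => Ideal.pow_le_pow_right h (hg i j)

theorem mem_maximalIdeal_pow {ϖ : 𝒪[F]} (hϖ : Irreducible ϖ) {n : ℕ} {x : 𝒪[F]} :
    x ∈ 𝓂[F] ^ n ↔ ϖ ^ n ∣ x := by
  rw [hϖ.maximalIdeal_eq, Ideal.span_singleton_pow, Ideal.mem_span_singleton]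

/-- An element outside `P^j` divides `ϖ^l` times anything, with quotient in `P^{l + 1 - j}`. -/
theorem exists_mul_eq_of_notMem {ϖ : 𝒪[F]} (hϖ : Irreducible ϖ) {i j l : ℕ} (hij : i + j = l + 1)
    {z : 𝒪[F]} (hz : z ∉ 𝓂[F] ^ j) (x : 𝒪[F]) : ∃ y ∈ 𝓂[F] ^ i, z * y = ϖ ^ l * x := by
  have hz0 : z ≠ 0 := by
    rintro rfl
    exact hz (zero_mem _)
  obtain ⟨n, u, rfl⟩ := IsDiscreteValuationRing.eq_unit_mul_pow_irreducible hz0 hϖ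
  have hn : n < j := by
    by_contra! h
    exact hz ((mem_maximalIdeal_pow hϖ).2 (dvd_mul_of_dvd_right (pow_dvd_pow _ h) _))
  refine ⟨ϖ ^ (l - n) * ((u⁻¹ : (𝒪[F])ˣ) * x), ?_, ?_⟩
  · rw [mem_maximalIdeal_pow hϖ]
    exact dvd_mul_of_dvd_left (pow_dvd_pow _ (by omega)) _
  · have e : ϖ ^ l = ϖ ^ n * ϖ ^ (l - n) := by rw [← pow_add]; congr 1; omega
    rw [e]
    have hu : (u : 𝒪[F]) * (u⁻¹ : (𝒪[F])ˣ) = 1 := u.mul_inv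
    linear_combination (ϖ ^ n * ϖ ^ (l - n) * x) * hu

theorem addChar_ne_zero {A : Type*} [AddGroup A] (ψ : AddChar A ℂ) (x : A) : ψ x ≠ 0 := by
  intro h
  have := AddChar.map_add_eq_mul ψ x (-x)
  rw [h, zero_mul, add_neg_cancel, AddChar.map_zero_eq_one] at this
  exact one_ne_zero this

omit [TopologicalSpace F] [IsNonarchimedeanLocalField F] in
theorem inv_pow_mul_pow_mul {ϖ : 𝒪[F]} (hϖ : Irreducible ϖ) (l : ℕ) (x : 𝒪[F]) :
    ((ϖ : F) ^ l)⁻¹ * ((ϖ ^ l * x : 𝒪[F]) : F) = x := by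
  have h0 : (ϖ : F) ≠ 0 := by simpa using hϖ.ne_zero
  push_cast
  field_simp

/-! ### Vanishing of biequivariant functions off S -/

section Criterion

variable {ψ : AddChar F ℂ} (hψ : HasConductorP ψ) {ϖ : 𝒪[F]} (hϖ : Irreducible ϖ)
  {S : Subgroup (GL (Fin 2) 𝒪[F])} {p r l : ℕ} (hr : 1 ≤ r) (hpr : p + r = l + 1)
  (hS : ∀ g : GL (Fin 2) 𝒪[F], g ∈ S ↔ g 0 1 ∈ 𝓂[F] ^ p ∧ g 0 0 - g 1 1 ∈ 𝓂[F] ^ r)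
  {η : S →* ℂ} (hη : ∀ s : S, s.1 0 0 = 1 → η s = ψ (((ϖ : F) ^ l)⁻¹ * (s.1 0 1 : 𝒪[F])))

include hψ hϖ hr hpr hS hη

/-- No function supported off `S` is biequivariant under the character `η`. -/
theorem eq_zero_of_biequivariant {φ : GL (Fin 2) 𝒪[F] → ℂ}
    (hl : ∀ (s : S) g, φ (s * g) = η s * φ g) (hrt : ∀ g (s : S), φ (g * s) = η s * φ g)
    (g : GL (Fin 2) 𝒪[F]) (hg : g ∉ S) : φ g = 0 := by
  obtain ⟨x₀, hx₀⟩ := hψ.nontrivial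
  -- The only obstruction used: an element a of S that g conjugates to an element of S with a
  -- different value of η. Each case below exhibits such a pair whose values of η have ratio ψ(x₀) ≠
  -- 1 or its inverse.
  have key : ∀ (a b : GL (Fin 2) 𝒪[F]) (ha : a ∈ S) (hb : b ∈ S) (g : GL (Fin 2) 𝒪[F]),
      a * g = g * b → η ⟨a, ha⟩ ≠ η ⟨b, hb⟩ → φ g = 0 := by
    intro a b ha hb g h1 h2
    by_contra h
    have h3 := hl ⟨a, ha⟩ g
    have h4 := hrt g ⟨b, hb⟩
    rw [← h1, h3] at h4
    exact h2 (mul_right_cancel₀ h h4)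
  have memlo : ∀ y : 𝒪[F], lowerUnip y ∈ S := fun y => by
    rw [hS, coe_lowerUnip]; simp
  have memup : ∀ x ∈ 𝓂[F] ^ p, upperUnip x ∈ S := fun x hx => by
    rw [hS, coe_upperUnip]; simpa using hx
  have ηlo : ∀ y : 𝒪[F], η ⟨_, memlo y⟩ = 1 := fun y => by
    rw [hη _ (by simp [coe_lowerUnip])]; simp [coe_lowerUnip]
  have ηup : ∀ x (hx : x ∈ 𝓂[F] ^ p), η ⟨_, memup x hx⟩ = ψ (((ϖ : F) ^ l)⁻¹ * (x : F)) :=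
    fun x hx => by
      rw [hη _ (by simp [coe_upperUnip])]; simp [coe_upperUnip]
  have hmem0 : ϖ ^ l * x₀ ∈ 𝓂[F] ^ p :=
    (mem_maximalIdeal_pow hϖ).2 (dvd_mul_of_dvd_left (pow_dvd_pow _ (by omega)) _)
  have hlo : ∀ (y : 𝒪[F]) g, φ (lowerUnip y * g) = φ g := fun y g => by
    have := hl ⟨_, memlo y⟩ g
    rwa [ηlo, one_mul] at this
  have hlo' : ∀ (y : 𝒪[F]) g, φ (g * lowerUnip y) = φ g := fun y g => by
    have := hrt g ⟨_, memlo y⟩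
    rwa [ηlo, one_mul] at this
  by_cases hb : IsUnit (g 0 1)
  · obtain ⟨b, hb⟩ := hb
    have hbb : g 0 1 * (b⁻¹ : (𝒪[F])ˣ) = 1 := by rw [← hb]; exact b.mul_inv
    -- Lower unipotents have trivial η, so g may be cleared to an antidiagonal w. It exchanges a
    -- lower unipotent with an upper one on which η equals ψ(x₀).
    obtain ⟨w, hw⟩ : ∃ w, w = lowerUnip (-(g 1 1 * (b⁻¹ : (𝒪[F])ˣ))) *
      (g * lowerUnip (-(g 0 0 * (b⁻¹ : (𝒪[F])ˣ)))) := ⟨_, rfl⟩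
    have hwφ : φ w = φ g := by rw [hw, hlo, hlo']
    rw [← hwφ]
    have w00 : w 0 0 = 0 := by
      rw [hw, Units.val_mul, Units.val_mul, coe_lowerUnip, coe_lowerUnip]
      simp [Matrix.mul_apply, Fin.sum_univ_two]
      linear_combination -(g 0 0) * hbb
    have w01 : w 0 1 = g 0 1 := by
      rw [hw, Units.val_mul, Units.val_mul, coe_lowerUnip, coe_lowerUnip]
      simp [Matrix.mul_apply, Fin.sum_univ_two]
    have w11 : w 1 1 = 0 := by
      rw [hw, Units.val_mul, Units.val_mul, coe_lowerUnip, coe_lowerUnip]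
      simp [Matrix.mul_apply, Fin.sum_univ_two]
      linear_combination -(g 1 1) * hbb
    refine key _ _ (memlo (w 1 0 * (ϖ ^ l * x₀) * (b⁻¹ : (𝒪[F])ˣ))) (memup _ hmem0) w ?_ ?_
    · apply Units.ext
      rw [Units.val_mul, Units.val_mul, coe_lowerUnip, coe_upperUnip]
      ext i j
      fin_cases i <;> fin_cases j <;> simp [Matrix.mul_apply, Fin.sum_univ_two, w00, w01, w11]
      have hbbF := congrArg (Subtype.val : 𝒪[F] → F) hbb
      push_cast at hbbF
      linear_combination ((w.1 1 0 : F) * ϖ ^ l * x₀) * hbbF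
    · rw [ηlo, ηup _ hmem0, inv_pow_mul_pow_mul hϖ]
      exact hx₀.symm
  · have hb' : g 0 1 ∈ 𝓂[F] := (IsLocalRing.mem_maximalIdeal _).2 hb
    obtain ⟨-, ⟨d, hd⟩⟩ := isUnit_diag_of_mem_maximalIdeal hb'
    have hdd : g 1 1 * (d⁻¹ : (𝒪[F])ˣ) = 1 := by rw [← hd]; exact d.mul_inv
    obtain ⟨t, ht⟩ : ∃ t, t = g * lowerUnip (-(g 1 0 * (d⁻¹ : (𝒪[F])ˣ))) := ⟨_, rfl⟩
    have htφ : φ t = φ g := by rw [ht, hlo']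
    have htS : t ∉ S := by rwa [ht, S.mul_mem_cancel_right (memlo _)]
    rw [← htφ]
    have t10 : t 1 0 = 0 := by
      rw [ht, Units.val_mul, coe_lowerUnip]
      simp [Matrix.mul_apply, Fin.sum_univ_two]
      linear_combination -(g 1 0) * hdd
    have t11 : t 1 1 = d := by
      rw [ht, Units.val_mul, coe_lowerUnip]
      simp [Matrix.mul_apply, Fin.sum_univ_two, hd]
    by_cases had : t 0 0 - t 1 1 ∈ 𝓂[F] ^ r
    · have htb : t 0 1 ∉ 𝓂[F] ^ p := fun h => htS ((hS t).2 ⟨h, had⟩)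
      -- Here e ∈ P^r is chosen so that diag(1, 1 + d e) lies in S and moving it across t changes
      -- the upper right entry by d ϖ^ℓ x₀. The unipotent correction absorbs that change.
      obtain ⟨e, he, hte⟩ := exists_mul_eq_of_notMem hϖ ((add_comm r p).trans hpr) htb x₀
      have he1 : IsUnit (1 + d * e : 𝒪[F]) := by
        have : (d * e : 𝒪[F]) ∈ 𝓂[F] :=
          Ideal.mul_mem_left _ _ (Ideal.pow_le_self (by omega) he)
        by_contra h
        have h2 := sub_mem ((IsLocalRing.mem_maximalIdeal _).2 h) this
        rw [add_sub_cancel_right] at h2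
        exact (IsLocalRing.mem_maximalIdeal _).1 h2 isUnit_one
      obtain ⟨v, hv⟩ := he1
      have hmemr : ∀ x ∈ 𝓂[F] ^ p, upperTri 1 v x ∈ S := fun x hx => by
        rw [hS, coe_upperTri]
        refine ⟨by simpa using hx, ?_⟩
        simp only [Matrix.of_apply, Matrix.cons_val', Matrix.cons_val_zero, Matrix.cons_val_one,
          Matrix.cons_val_fin_one, hv, Units.val_one]
        have : (1 : 𝒪[F]) - (1 + d * e) = -(d * e) := by ring
        rw [this]
        exact neg_mem (Ideal.mul_mem_left _ _ he)
      refine key _ _ (hmemr _ hmem0) (hmemr 0 (zero_mem _)) t ?_ ?_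
      · apply Units.ext
        rw [Units.val_mul, Units.val_mul, coe_upperTri, coe_upperTri]
        ext i j
        fin_cases i <;> fin_cases j <;>
          simp [Matrix.mul_apply, Fin.sum_univ_two, t10, t11, hv]
        · have hteF := congrArg (Subtype.val : 𝒪[F] → F) hte
          push_cast at hteF
          linear_combination (-(d.1 : F)) * hteF
        · ring
      · rw [hη _ (by simp [coe_upperTri]), hη _ (by simp [coe_upperTri])]
        simp only [coe_upperTri, Matrix.of_apply, Matrix.cons_val', Matrix.cons_val_zero,
          Matrix.cons_val_one, Matrix.cons_val_fin_one]
        rw [inv_pow_mul_pow_mul hϖ, ZeroMemClass.coe_zero, mul_zero, AddChar.map_zero_eq_one]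
        exact hx₀
    · obtain ⟨x, hx, htx⟩ := exists_mul_eq_of_notMem hϖ hpr had x₀
      refine key _ _ (memup (t 0 0 * x) (Ideal.mul_mem_left _ _ hx))
        (memup (t 1 1 * x) (Ideal.mul_mem_left _ _ hx)) t ?_ ?_
      · apply Units.ext
        rw [Units.val_mul, Units.val_mul, coe_upperUnip, coe_upperUnip]
        ext i j
        fin_cases i <;> fin_cases j <;>
          simp [Matrix.mul_apply, Fin.sum_univ_two, t10]
        ring
      · rw [ηup _ (Ideal.mul_mem_left _ _ hx), ηup _ (Ideal.mul_mem_left _ _ hx)]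
        have e : t 0 0 * x = t 1 1 * x + ϖ ^ l * x₀ := by linear_combination htx
        rw [e, Subring.coe_add, mul_add, AddChar.map_add_eq_mul, inv_pow_mul_pow_mul hϖ]
        intro h
        apply hx₀
        apply mul_left_cancel₀ (addChar_ne_zero ψ (((ϖ : F) ^ l)⁻¹ * ((t 1 1 * x : 𝒪[F]) : F)))
        rw [h, mul_one]

end Criterion

end Local

/-! ### Embeddings into irreducible representations -/

/-- A nonzero representation embedding into an irreducible one is irreducible, and the embedding is
an isomorphism. -/
theorem isIrreducible_of_injective {k G V W : Type*} [Field k] [Monoid G] [AddCommGroup V]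
    [Module k V] [AddCommGroup W] [Module k W] {ρ : Representation k G V}
    {σ : Representation k G W} [σ.IsIrreducible] (Φ : ρ.IntertwiningMap σ)
    (hΦ : Function.Injective Φ) (hV : ∃ v : V, v ≠ 0) :
    ρ.IsIrreducible ∧ Function.Bijective Φ := by
  have image : ∀ U : Subrepresentation ρ, U.toSubmodule ≠ ⊥ →
      U.toSubmodule.map Φ.toLinearMap = ⊤ := by
    intro U hU
    let T : Subrepresentation σ :=
      { toSubmodule := U.toSubmodule.map Φ.toLinearMap
        apply_mem_toSubmodule := by
          rintro g _ ⟨u, hu, rfl⟩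
          exact ⟨ρ g u, U.apply_mem_toSubmodule g hu, Φ.isIntertwining _ _ g u⟩ }
    have hT : T = ⊤ := by
      refine (eq_bot_or_eq_top T).resolve_left fun h => hU ?_
      rw [eq_bot_iff]
      intro u hu
      have h1 : Φ u ∈ T.toSubmodule := ⟨u, hu, rfl⟩
      rw [h] at h1
      have h2 : Φ u = 0 := (Submodule.mem_bot k).1 h1
      exact (Submodule.mem_bot k).2 (hΦ (h2.trans (map_zero Φ).symm))
    exact congrArg Subrepresentation.toSubmodule hT
  obtain ⟨v, hv⟩ := hV
  have hne : (⊤ : Subrepresentation ρ).toSubmodule ≠ ⊥ := fun h =>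
    hv ((Submodule.mem_bot k).1 (h ▸ (Submodule.mem_top : v ∈ (⊤ : Submodule k V))))
  refine ⟨{ exists_pair_ne := ⟨⊥, ⊤, fun h => hne (h ▸ rfl)⟩, eq_bot_or_eq_top := fun U => ?_ },
    hΦ, fun w => ?_⟩
  · by_cases hU : U.toSubmodule = ⊥
    · exact Or.inl (Subrepresentation.toSubmodule_injective hU)
    · refine Or.inr (eq_top_iff.2 fun x _ => ?_)
      have hx : Φ x ∈ U.toSubmodule.map Φ.toLinearMap := by
        rw [image U hU]; exact Submodule.mem_top
      obtain ⟨u, hu, hux⟩ := hx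
      rw [← hΦ hux]
      exact hu
  · have hw : w ∈ (⊤ : Subrepresentation ρ).toSubmodule.map Φ.toLinearMap := by
      rw [image ⊤ hne]; exact Submodule.mem_top
    obtain ⟨u, _, hu⟩ := hw
    exact ⟨u, hu⟩

/-! ### Reduction of the twisted representation and its Whittaker character -/

section Local

variable {F : Type*} [Field F] [ValuativeRel F] [TopologicalSpace F]
  [IsNonarchimedeanLocalField F]

variable (F) in
/-- The matrices `g` of `K` with `g₁₂ ∈ P^p` and `g₁₁ - g₂₂ ∈ P^r`. -/
def nearScalar (p r : ℕ) (hrp : r ≤ p) : Subgroup (GL (Fin 2) 𝒪[F]) where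
  carrier := {g | g 0 1 ∈ 𝓂[F] ^ p ∧ g 0 0 - g 1 1 ∈ 𝓂[F] ^ r}
  one_mem' := by simp
  mul_mem' := by
    rintro a b ⟨ha, ha'⟩ ⟨hb, hb'⟩
    have hle : 𝓂[F] ^ p ≤ 𝓂[F] ^ r := Ideal.pow_le_pow_right hrp
    refine ⟨?_, ?_⟩
    · rw [Units.val_mul, Matrix.mul_apply, Fin.sum_univ_two]
      exact add_mem (Ideal.mul_mem_left _ _ hb) (Ideal.mul_mem_right _ _ ha)
    · have : (a * b) 0 0 - (a * b) 1 1 = a 0 0 * (b 0 0 - b 1 1) + b 1 1 * (a 0 0 - a 1 1)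
          + (b 1 0 * a 0 1 - a 1 0 * b 0 1) := by
        simp only [Units.val_mul, Matrix.mul_apply, Fin.sum_univ_two]; ring
      rw [this]
      exact add_mem (add_mem (Ideal.mul_mem_left _ _ hb') (Ideal.mul_mem_left _ _ ha'))
        (sub_mem (Ideal.mul_mem_left _ _ (hle ha)) (Ideal.mul_mem_left _ _ (hle hb)))
  inv_mem' := by
    rintro a ⟨ha, ha'⟩
    refine ⟨?_, ?_⟩
    · rw [inv_zero_one]
      exact neg_mem (Ideal.mul_mem_left _ _ ha)
    · rw [inv_sub]
      exact neg_mem (Ideal.mul_mem_left _ _ ha')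

theorem nearScalar_le_lowerTri {p r : ℕ} (hrp : r ≤ p) : nearScalar F p r hrp ≤ lowerTri F p :=
  fun _ h => h.1

theorem congrSub_le_of_mem_iff {S : Subgroup (GL (Fin 2) 𝒪[F])} {p r n : ℕ} (hp : p ≤ n)
    (hr : r ≤ n) (hS : ∀ g : GL (Fin 2) 𝒪[F], g ∈ S ↔ g 0 1 ∈ 𝓂[F] ^ p ∧ g 0 0 - g 1 1 ∈ 𝓂[F] ^ r) :
    congrSub F n ≤ S := by
  intro g hg
  rw [mem_congrSub] at hg
  rw [hS]
  have h01 := hg 0 1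
  have h := sub_mem (hg 0 0) (hg 1 1)
  simp only [Matrix.one_apply_eq, sub_sub_sub_cancel_right] at h
  rw [Matrix.one_apply_ne (by decide), sub_zero] at h01
  exact ⟨Ideal.pow_le_pow_right hp h01, Ideal.pow_le_pow_right hr h⟩

variable (F) in
/-- A set-theoretic section of the reduction map. -/
def residueLift : 𝓀[F] → 𝒪[F] := Function.surjInv IsLocalRing.residue_surjective

theorem residue_residueLift (y : 𝓀[F]) : IsLocalRing.residue 𝒪[F] (residueLift F y) = y :=
  Function.surjInv_eq IsLocalRing.residue_surjective y

/-- The character of the residue field induced by `ψ`. -/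
def residueChar (ψ : AddChar F ℂ) (hψ : HasConductorP ψ) : AddChar 𝓀[F] ℂ where
  toFun y := ψ ((residueLift F y : 𝒪[F]) : F)
  map_zero_eq_one' := hψ.trivial _ (by
    rw [← IsLocalRing.residue_eq_zero_iff, residue_residueLift])
  map_add_eq_mul' x y := by
    have h : residueLift F (x + y) -
        (residueLift F x +
          residueLift F y) ∈ 𝓂[F] := by
      rw [← IsLocalRing.residue_eq_zero_iff, map_sub, map_add, residue_residueLift,
        residue_residueLift, residue_residueLift, sub_self]
    have h1 := hψ.trivial _ h
    rw [← AddChar.map_add_eq_mul, ← mul_one (ψ (_ + _)), ← h1, ← AddChar.map_add_eq_mul]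
    congr 1
    push_cast
    ring

theorem residueChar_residue (ψ : AddChar F ℂ) (hψ : HasConductorP ψ) (x : 𝒪[F]) :
    residueChar ψ hψ (IsLocalRing.residue _ x) = ψ (x : F) := by
  have h : residueLift F
      (IsLocalRing.residue _ x) - x ∈ 𝓂[F] := by
    rw [← IsLocalRing.residue_eq_zero_iff, map_sub, residue_residueLift, sub_self]
  have h1 := hψ.trivial _ h
  change ψ ((residueLift F (IsLocalRing.residue _ x) : 𝒪[F]) : F)
    = _
  rw [← mul_one (ψ (x : F)), ← h1, ← AddChar.map_add_eq_mul]
  congr 1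
  push_cast
  ring

theorem residueChar_ne_one (ψ : AddChar F ℂ) (hψ : HasConductorP ψ) : residueChar ψ hψ ≠ 1 := by
  obtain ⟨x, hx⟩ := hψ.nontrivial
  intro h
  apply hx
  rw [← residueChar_residue ψ hψ, h, AddChar.one_apply]

variable {ϖ : 𝒪[F]} (hϖ : Irreducible ϖ)

theorem conj_entries {l : ℕ} (b : lowerTri F l) :
    (conj ϖ hϖ l b) 0 0 = b.1 0 0 ∧ (conj ϖ hϖ l b) 1 1 = b.1 1 1 ∧
      ϖ ^ l * (conj ϖ hϖ l b) 0 1 = b.1 0 1 ∧ (conj ϖ hϖ l b) 1 0 = ϖ ^ l * b.1 1 0 := by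
  have h0 : (ϖ : F) ≠ 0 := by simpa using hϖ.ne_zero
  have h := incl_conj ϖ hϖ l b
  rw [mul_assoc, eq_inv_mul_iff_mul_eq] at h
  have h1 : ∀ i j, (gEll ϖ hϖ l * incl (conj ϖ hϖ l b)) i j = (incl b.1 * gEll ϖ hϖ l) i j :=
    fun i j => by rw [h]
  have hg : (gEll ϖ hϖ l).1 = !![(ϖ : F) ^ l, 0; 0, 1] := rfl
  have hi : ∀ (k : GL (Fin 2) 𝒪[F]) i j, (incl k).1 i j = ((k i j : 𝒪[F]) : F) := fun _ _ _ => rfl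
  simp only [Units.val_mul, Matrix.mul_apply, Fin.sum_univ_two, hg, hi] at h1
  refine ⟨?_, ?_, ?_, ?_⟩ <;> apply Subtype.val_injective
  · have := h1 0 0
    simp only [Matrix.of_apply, Matrix.cons_val', Matrix.cons_val_zero, Matrix.cons_val_one,
      Matrix.cons_val_fin_one, zero_mul, mul_zero, add_zero] at this
    exact mul_left_cancel₀ (pow_ne_zero l h0) (this.trans (mul_comm _ _))
  · simpa using h1 1 1
  · simpa using h1 0 1
  · have := h1 1 0
    simpa [mul_comm] using this

/-- Conjugation by g_ℓ divides the upper right entry by ϖ^ℓ and multiplies the lower left one by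
ϖ^ℓ, which kills it mod P as ℓ ≥ 1. Diagonal entries congruent mod P then put the reduction in ZU.
-/
theorem map_residue_conj {l : ℕ} (hl : 1 ≤ l) (b : lowerTri F l) (hb : b.1 0 0 - b.1 1 1 ∈ 𝓂[F])
    (u : (𝒪[F])ˣ) (hu : (u : 𝒪[F]) = b.1 0 0) (c : 𝒪[F]) (hc : b.1 0 1 = ϖ ^ l * c) :
    Matrix.GeneralLinearGroup.map (IsLocalRing.residue 𝒪[F]) (conj ϖ hϖ l b) =
      Matrix.GeneralLinearGroup.scalar (Fin 2)
        (Units.map (IsLocalRing.residue 𝒪[F]).toMonoidHom u) *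
      unip (IsLocalRing.residue 𝒪[F] ((u⁻¹ : (𝒪[F])ˣ) * c)) := by
  obtain ⟨h00, h11, h01, h10⟩ := conj_entries hϖ b
  rw [hc] at h01
  replace h01 := mul_left_cancel₀ (pow_ne_zero l hϖ.ne_zero) h01
  have hres : IsLocalRing.residue 𝒪[F] (b.1 1 1) = IsLocalRing.residue 𝒪[F] u := by
    rw [eq_comm, ← sub_eq_zero, ← map_sub, IsLocalRing.residue_eq_zero_iff, hu]
    exact hb
  have hϖ0 : IsLocalRing.residue 𝒪[F] ϖ = 0 := by
    rw [IsLocalRing.residue_eq_zero_iff, hϖ.maximalIdeal_eq]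
    exact Ideal.mem_span_singleton_self ϖ
  apply Units.ext
  rw [Units.val_mul, coe_unip]
  ext i j
  rw [Matrix.GeneralLinearGroup.map_apply]
  fin_cases i <;> fin_cases j
  · simp [Matrix.mul_apply, Fin.sum_univ_two, h00, ← hu]
  · simp [Matrix.mul_apply, Fin.sum_univ_two, h01]
  · simp [Matrix.mul_apply, Fin.sum_univ_two, h10, hϖ0, Nat.one_le_iff_ne_zero.1 hl]
  · simp [Matrix.mul_apply, Fin.sum_univ_two, h11, hres]

include hϖ in
-- Level ℓ + 1 rather than ℓ leaves a spare factor ϖ in c, so both the central part and the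
-- unipotent part reduce to the identity.
theorem exists_unit_of_mem_congrSub {n l : ℕ} (hn : l + 1 ≤ n) {g : GL (Fin 2) 𝒪[F]}
    (hg : g ∈ congrSub F n) : ∃ (u : (𝒪[F])ˣ) (c : 𝒪[F]), (u : 𝒪[F]) = g 0 0 ∧
      g 0 1 = ϖ ^ l * c ∧ (u : 𝒪[F]) - 1 ∈ 𝓂[F] ∧ c ∈ 𝓂[F] := by
  rw [mem_congrSub] at hg
  have h00 := hg 0 0
  have h01 := hg 0 1
  rw [Matrix.one_apply_eq] at h00
  rw [Matrix.one_apply_ne (by decide), sub_zero] at h01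
  have hm : ∀ {x}, x ∈ 𝓂[F] ^ n → x ∈ 𝓂[F] := fun hx => Ideal.pow_le_self (by omega) hx
  obtain ⟨⟨u, hu⟩, -⟩ := isUnit_diag_of_mem_maximalIdeal (hm h01)
  obtain ⟨c, hc⟩ := (mem_maximalIdeal_pow hϖ).1 (Ideal.pow_le_pow_right hn h01)
  refine ⟨u, ϖ * c, hu, by rw [hc]; ring, hu ▸ hm h00, Ideal.mul_mem_right _ _ ?_⟩
  rw [hϖ.maximalIdeal_eq]
  exact Ideal.mem_span_singleton_self ϖ

theorem map_residue_unit_eq_one {u : (𝒪[F])ˣ} (hu : (u : 𝒪[F]) - 1 ∈ 𝓂[F]) :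
    Units.map (IsLocalRing.residue 𝒪[F]).toMonoidHom u = 1 := by
  ext
  have := (IsLocalRing.residue_eq_zero_iff _).2 hu
  rw [map_sub, sub_eq_zero] at this
  simpa using this

variable {V : Type*} [AddCommGroup V] [Module ℂ V] (σ : Representation ℂ (GL (Fin 2) 𝓀[F]) V)

theorem twist_infl_apply {l : ℕ} (b : lowerTri F l) : twist ϖ hϖ l (infl σ) b =
    σ (Matrix.GeneralLinearGroup.map (IsLocalRing.residue 𝒪[F]) (conj ϖ hϖ l b)) := rfl

theorem congrSub_le_lowerTri (l : ℕ) : congrSub F (l + 1) ≤ lowerTri F l := by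
  intro g hg
  have := (mem_congrSub.1 hg) 0 1
  rw [Matrix.one_apply_ne (by decide), sub_zero] at this
  exact Ideal.pow_le_pow_right (Nat.le_succ l) this

theorem twist_infl_eq_one {l : ℕ} (hl : 1 ≤ l) (g : GL (Fin 2) 𝒪[F]) (hg : g ∈ congrSub F (l + 1)) :
    twist ϖ hϖ l (infl σ) ⟨g, congrSub_le_lowerTri l hg⟩ = 1 := by
  obtain ⟨u, c, hu, hc, hu1, hc1⟩ := exists_unit_of_mem_congrSub hϖ le_rfl hg
  have hd : g 0 0 - g 1 1 ∈ 𝓂[F] := by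
    have h := sub_mem (mem_congrSub.1 hg 0 0) (mem_congrSub.1 hg 1 1)
    simp only [Matrix.one_apply_eq, sub_sub_sub_cancel_right] at h
    exact Ideal.pow_le_self (by omega) h
  rw [twist_infl_apply, map_residue_conj hϖ hl _ hd u hu c hc, map_residue_unit_eq_one hu1, map_one,
    one_mul, (IsLocalRing.residue_eq_zero_iff _).2 (Ideal.mul_mem_left _ _ hc1), unip_zero, map_one]

/-- H acts on V through ZU, for which L is an eigenfunctional. Since L v₀ = 1, the eigenvalue is
L(τ(h) v₀). The explicit formula serves for comparison with `etaHat`. -/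
theorem exists_whittaker_character {ψ : AddChar F ℂ} (hψ : HasConductorP ψ) {l : ℕ} (hl : 1 ≤ l)
    {ω : (𝓀[F])ˣ →* ℂˣ} (hω : HasCentralCharacter σ ω) {L : V →ₗ[ℂ] ℂ} {v₀ : V} (h1 : L v₀ = 1)
    (hL : ∀ x v, L (σ (unip x) v) = residueChar ψ hψ x * L v) :
    ∃ χ : nearScalar F l 1 hl →* ℂ,
      (∀ h v, L (twist ϖ hϖ l (infl σ) ⟨h.1, nearScalar_le_lowerTri hl h.2⟩ v) = χ h * L v) ∧
      ∀ (h : nearScalar F l 1 hl) (u : (𝒪[F])ˣ) (c : 𝒪[F]), (u : 𝒪[F]) = h.1 0 0 →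
        h.1 0 1 = ϖ ^ l * c →
        χ h = (inflChar ω u : ℂ) * ψ (((u⁻¹ : (𝒪[F])ˣ) * c : 𝒪[F]) : F) := by
  let τ : Representation ℂ (nearScalar F l 1 hl) V :=
    (twist ϖ hϖ l (infl σ)).comp (Subgroup.inclusion (nearScalar_le_lowerTri hl))
  have key : ∀ (h : nearScalar F l 1 hl) (u : (𝒪[F])ˣ) (c : 𝒪[F]), (u : 𝒪[F]) = h.1 0 0 →
      h.1 0 1 = ϖ ^ l * c → ∀ v, L (τ h v) =
        (inflChar ω u : ℂ) * ψ (((u⁻¹ : (𝒪[F])ˣ) * c : 𝒪[F]) : F) * L v := by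
    intro h u c hu hc v
    have hd : h.1 0 0 - h.1 1 1 ∈ 𝓂[F] := by simpa using h.2.2
    change L (twist ϖ hϖ l (infl σ) ⟨h.1, nearScalar_le_lowerTri hl h.2⟩ v) = _
    rw [twist_infl_apply, map_residue_conj hϖ hl _ hd u hu c hc, map_mul, Module.End.mul_apply,
      hω, map_smul, hL, residueChar_residue, smul_eq_mul, mul_assoc]
    rfl
  have key' : ∀ (h : nearScalar F l 1 hl) v, L (τ h v) = L (τ h v₀) * L v := by
    intro h v
    have hb : h.1 0 1 ∈ 𝓂[F] := Ideal.pow_le_self (by omega) h.2.1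
    obtain ⟨⟨u, hu⟩, -⟩ := isUnit_diag_of_mem_maximalIdeal hb
    obtain ⟨c, hc⟩ := (mem_maximalIdeal_pow hϖ).1 h.2.1
    rw [key h u c hu hc, key h u c hu hc, h1, mul_one]
  refine ⟨{ toFun := fun h => L (τ h v₀), map_one' := ?_, map_mul' := fun a b => ?_ }, key',
    fun h u c hu hc => ?_⟩
  · rw [map_one, Module.End.one_apply, h1]
  · rw [map_mul, Module.End.mul_apply, key']
  · change L (τ h v₀) = _
    rw [key h u c hu hc, h1, mul_one]

/-- Composition with a functional equivariant under a smaller group, as an intertwining map of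
induced representations. -/
def compFunctional {G : Type*} [Group G] [TopologicalSpace G] [IsTopologicalGroup G]
    {B H N : Subgroup G} [N.FiniteIndex] (hN : IsOpen (N : Set G)) (hNH : N ≤ H) (hHB : H ≤ B)
    (τ : Representation ℂ B V) (hτ : ∀ n (hn : n ∈ N), τ ⟨n, hHB (hNH hn)⟩ = 1) (χ : H →* ℂ)
    (L : V →ₗ[ℂ] ℂ) (hL : ∀ h v, L (τ ⟨h.1, hHB h.2⟩ v) = χ h * L v) :
    (ind B τ).IntertwiningMap (ind H (charRep χ)) :=
  LinearMap.intertwiningMap_of_isIntertwiningMap _ _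
    { toFun := fun f => ⟨fun g => L (f.1 g), mem_indSpace N hN hNH
        (fun h g => by
          have := f.2.1 ⟨h.1, hHB h.2⟩ g
          simp only at this
          rw [this, hL]
          simp [charRep])
        (fun n hn g => by rw [apply_mul_left_of_mem (hNH.trans hHB) hτ f hn])⟩
      map_add' := fun f₁ f₂ => by ext g; simp
      map_smul' := fun a f => by ext g; simp }
    (fun x f => rfl)

end Local

/-! ### Irreducibility for the two inducing groups, and the lower bound for the depth -/

section Local

variable {F : Type*} [Field F] [ValuativeRel F] [TopologicalSpace F]
  [IsNonarchimedeanLocalField F]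
variable {ϖ : 𝒪[F]} (hϖ : Irreducible ϖ) {ψ : AddChar F ℂ} (hψ : HasConductorP ψ)

include hψ hϖ in
/-- Irreducibility of the representations induced from the groups of matrices with `g₁₂ ∈ P^p`,
`g₁₁ - g₂₂ ∈ P^r`, where `p + r = l + 1`. -/
theorem isIrreducible_ind {S : Subgroup (GL (Fin 2) 𝒪[F])} {p r l : ℕ} (hr : 1 ≤ r)
    (hpr : p + r = l + 1)
    (hS : ∀ g : GL (Fin 2) 𝒪[F], g ∈ S ↔ g 0 1 ∈ 𝓂[F] ^ p ∧ g 0 0 - g 1 1 ∈ 𝓂[F] ^ r)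
    (hNS : congrSub F (l + 1) ≤ S) {η : S →* ℂ}
    (hηN : ∀ n (hn : n ∈ congrSub F (l + 1)), η ⟨n, hNS hn⟩ = 1)
    (hη : ∀ s : S, s.1 0 0 = 1 → η s = ψ (((ϖ : F) ^ l)⁻¹ * (s.1 0 1 : 𝒪[F]))) :
    (ind S (charRep η)).IsIrreducible :=
  ind_isIrreducible (isOpen_congrSub (l + 1)) hNS hηN
    fun _ hl hrt g hg => eq_zero_of_biequivariant hψ hϖ hr hpr hS hη hl hrt g hg

variable {V : Type*} [AddCommGroup V] [Module ℂ V] (σ : Representation ℂ (GL (Fin 2) 𝓀[F]) V)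

/-- A vector of the Mackey component fixed by `K_l` vanishes if the unipotent radical has no
nonzero fixed vectors. -/
theorem eq_zero_of_congrSub_fixed (hσ : ∀ v : V, (∀ x : 𝓀[F], σ (unip x) v = v) → v = 0) {l : ℕ}
    (hl : 1 ≤ l) (f : indSpace (lowerTri F l) (twist ϖ hϖ l (infl σ)))
    (hf : ∀ k ∈ congrSub F l, mackey ϖ hϖ l σ k f = f) : f = 0 := by
  ext g
  refine hσ _ fun x => ?_
  obtain ⟨y, rfl⟩ := IsLocalRing.residue_surjective (R := 𝒪[F]) x
  have hmem : ϖ ^ l * y ∈ 𝓂[F] ^ l := (mem_maximalIdeal_pow hϖ).2 (dvd_mul_right _ _)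
  have hB : upperUnip (ϖ ^ l * y) ∈ lowerTri F l := by
    change (upperUnip (ϖ ^ l * y)).1 0 1 ∈ 𝓂[F] ^ l
    rw [coe_upperUnip]
    simpa using hmem
  have hN : upperUnip (ϖ ^ l * y) ∈ congrSub F l := by
    rw [mem_congrSub, coe_upperUnip]
    intro i j
    fin_cases i <;> fin_cases j <;> simp
    exact hmem
  have h1 := f.2.1 ⟨_, hB⟩ g
  rw [twist_infl_apply, map_residue_conj hϖ hl _ (by simp [coe_upperUnip]) 1
    (by simp [coe_upperUnip]) y (by simp [coe_upperUnip]), map_one, map_one, one_mul, inv_one,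
    Units.val_one, one_mul] at h1
  rw [← h1]
  -- K_ℓ is normal, so left translation by this unipotent is right translation by an element of K_ℓ,
  -- which fixes f. Equivariance turns it into σ(unip x) acting on the value f(g).
  have h2 := hf _ ((congrSub_normal (F := F) l).conj_mem _ hN g⁻¹)
  have h3 : f.1 (g * (g⁻¹ * upperUnip (ϖ ^ l * y) * g⁻¹⁻¹)) = f.1 g :=
    congrFun (congrArg Subtype.val h2) g
  rw [← h3]
  group

theorem etaHat_eq_one (ω : (𝓀[F])ˣ →* ℂˣ) {l : ℕ} (hl : 1 ≤ l) (hNS : congrSub F (l + 1) ≤ Gam F l)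
    (n : GL (Fin 2) 𝒪[F]) (hn : n ∈ congrSub F (l + 1)) :
    etaHat ψ hψ ϖ hϖ (inflChar ω) l (inflChar_trivialOn ω hl) ⟨n, hNS hn⟩ = 1 := by
  obtain ⟨u, c, hu, hc, hu1, hc1⟩ := exists_unit_of_mem_congrSub hϖ le_rfl hn
  have ha : Gam.a (⟨n, hNS hn⟩ : Gam F l) = u := by
    ext
    simp [Gam.a, hu]
  change (inflChar ω (Gam.a (⟨n, hNS hn⟩ : Gam F l)) : ℂ) * ψ (((ϖ : F) ^ l)⁻¹ *
    (((Gam.a (⟨n, hNS hn⟩ : Gam F l))⁻¹ : (𝒪[F])ˣ) * n 0 1 : 𝒪[F])) = 1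
  rw [ha, hc, mul_left_comm, inv_pow_mul_pow_mul hϖ, hψ.trivial _ (Ideal.mul_mem_left _ _ hc1),
    inflChar, MonoidHom.comp_apply, map_residue_unit_eq_one hu1]
  simp

/-- Whatever the parity of ℓ, `mUp l + mLow l = l + 1`, which is the balance required by the general
criterion. -/
theorem isIrreducible_J (ω : (𝓀[F])ˣ →* ℂˣ) {l : ℕ} (hl : 1 ≤ l) :
    (J ψ hψ ϖ hϖ (inflChar ω) l (inflChar_trivialOn ω hl)).IsIrreducible := by
  have hS : ∀ g : GL (Fin 2) 𝒪[F], g ∈ Gam F l ↔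
      g 0 1 ∈ 𝓂[F] ^ mUp l ∧ g 0 0 - g 1 1 ∈ 𝓂[F] ^ mLow l := fun _ => Iff.rfl
  have hNS : congrSub F (l + 1) ≤ Gam F l :=
    congrSub_le_of_mem_iff (by unfold mUp; omega) (by unfold mLow; omega) hS
  refine isIrreducible_ind hϖ hψ (by unfold mLow; omega)
    (by unfold mUp mLow; omega) hS hNS (etaHat_eq_one hϖ hψ ω hl hNS) fun s hs => ?_
  have ha : Gam.a s = 1 := by
    ext
    simp [Gam.a, hs]
  change (inflChar ω (Gam.a s) : ℂ) * ψ (((ϖ : F) ^ l)⁻¹ *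
    (((Gam.a s)⁻¹ : (𝒪[F])ˣ) * s.1 0 1 : 𝒪[F])) = _
  rw [ha]
  simp

end Local

end BranchGL2

end

/-! ### Proof of the proposition -/

open BranchGL2 in
theorem proposition7p5 {F : Type*} [Field F] [ValuativeRel F] [TopologicalSpace F]
    [IsNonarchimedeanLocalField F] [CharP 𝓀[F] 2]
    (ϖ : 𝒪[F]) (hϖ : Irreducible ϖ)
    (ψ : AddChar F ℂ) (hψ : BranchGL2.HasConductorP ψ)
    {V : Type*} [AddCommGroup V] [Module ℂ V]
    (σ : Representation ℂ (GL (Fin 2) 𝓀[F]) V) (hσ : BranchGL2.IsCuspidal σ)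
    (ω : (𝓀[F])ˣ →* ℂˣ) (hω : BranchGL2.HasCentralCharacter σ ω)
    (l : ℕ) (hl : 1 ≤ l) :
    Nonempty ((BranchGL2.J ψ hψ ϖ hϖ (BranchGL2.inflChar ω) l
        (BranchGL2.inflChar_trivialOn ω hl)).Equiv (BranchGL2.mackey ϖ hϖ l σ)) ∧
      (BranchGL2.mackey ϖ hϖ l σ).IsIrreducible ∧
      BranchGL2.HasDepth (BranchGL2.mackey ϖ hϖ l σ) l := by
  let _ : Fintype 𝓀[F] := Fintype.ofFinite _
  obtain ⟨v₀, L, hL1, hL, hsep⟩ := hσ.exists_whittaker (residueChar_ne_one ψ hψ)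
  have hv₀ : v₀ ≠ 0 := by
    rintro rfl
    rw [map_zero] at hL1
    exact zero_ne_one hL1
  obtain ⟨χ, hχ, hχf⟩ := exists_whittaker_character hϖ σ hψ hl hω hL1 hL
  have hopen := isOpen_congrSub (F := F) (l + 1)
  have hS : ∀ g : GL (Fin 2) 𝒪[F], g ∈ nearScalar F l 1 hl ↔
      g 0 1 ∈ 𝓂[F] ^ l ∧ g 0 0 - g 1 1 ∈ 𝓂[F] ^ 1 := fun _ => Iff.rfl
  have hNH : congrSub F (l + 1) ≤ nearScalar F l 1 hl :=
    congrSub_le_of_mem_iff (by omega) (by omega) hS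
  have hNG : congrSub F (l + 1) ≤ Gam F l :=
    congrSub_le_of_mem_iff (p := mUp l) (r := mLow l) (by unfold mUp; omega)
      (by unfold mLow; omega) fun _ => Iff.rfl
  have hχN : ∀ n (hn : n ∈ congrSub F (l + 1)), χ ⟨n, hNH hn⟩ = 1 := by
    intro n hn
    have h := hχ ⟨n, hNH hn⟩ v₀
    simp only at h
    rwa [twist_infl_eq_one hϖ σ hl n hn, Module.End.one_apply, hL1, mul_one, eq_comm] at h
  -- The criterion at its extreme case p = ℓ, r = 1.
  have hI : (ind (nearScalar F l 1 hl) (charRep χ)).IsIrreducible := by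
    refine isIrreducible_ind hϖ hψ le_rfl rfl hS hNH hχN fun s hs => ?_
    obtain ⟨c, hc⟩ := (mem_maximalIdeal_pow hϖ).1 s.2.1
    rw [hχf s 1 c (by rw [hs, Units.val_one]) hc, hc, inv_pow_mul_pow_mul hϖ]
    simp
  have hJ := isIrreducible_J hϖ hψ ω hl
  set Φ := compFunctional hopen hNH (nearScalar_le_lowerTri hl) (twist ϖ hϖ l (infl σ))
    (twist_infl_eq_one hϖ σ hl) χ L hχ with hΦ
  -- Every upper triangular b over the residue field is the reduction of a conjugate of an element
  -- of B_ℓ. So L ∘ f = 0 kills all Borel translates of each value of f, and these separate vectors.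
  have hΦi : Function.Injective Φ := by
    rw [injective_iff_map_eq_zero]
    intro f hf
    have hf' : ∀ g, L (f.1 g) = 0 := fun g => congrFun (congrArg Subtype.val hf) g
    ext g
    refine hsep _ fun b hb => ?_
    have hdet := det_ne_zero_fin_two b
    rw [hb, mul_zero, sub_zero] at hdet
    obtain ⟨a, ha⟩ := IsLocalRing.residue_surjective (R := 𝒪[F]) (b 0 0)
    obtain ⟨d, hd⟩ := IsLocalRing.residue_surjective (R := 𝒪[F]) (b 1 1)
    obtain ⟨c, hc⟩ := IsLocalRing.residue_surjective (R := 𝒪[F]) (b 0 1)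
    obtain ⟨a, rfl⟩ : IsUnit a := (IsLocalRing.residue_ne_zero_iff_isUnit a).1
      (by rw [ha]; exact left_ne_zero_of_mul hdet)
    obtain ⟨d, rfl⟩ : IsUnit d := (IsLocalRing.residue_ne_zero_iff_isUnit d).1
      (by rw [hd]; exact right_ne_zero_of_mul hdet)
    have hmem : upperTri a d (ϖ ^ l * c) ∈ lowerTri F l := by
      change (upperTri a d (ϖ ^ l * c)).1 0 1 ∈ 𝓂[F] ^ l
      rw [coe_upperTri]
      exact (mem_maximalIdeal_pow hϖ).2 (dvd_mul_right _ _)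
    have hred : Matrix.GeneralLinearGroup.map (IsLocalRing.residue 𝒪[F])
        (conj ϖ hϖ l ⟨_, hmem⟩) = b := by
      obtain ⟨h00, h11, h01, h10⟩ := conj_entries hϖ ⟨_, hmem⟩
      simp only [coe_upperTri] at h00 h11 h01 h10
      replace h01 := mul_left_cancel₀ (pow_ne_zero l hϖ.ne_zero) h01
      apply Units.ext
      ext i j
      rw [Matrix.GeneralLinearGroup.map_apply]
      fin_cases i <;> fin_cases j
      · simp [h00, ha]
      · simp [h01, hc]
      · simp [h10, hb]
      · simp [h11, hd]
    rw [← hred, ← twist_infl_apply, ← f.2.1]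
    exact hf' _
  set f₀ := extendByZero (twist ϖ hϖ l (infl σ)) hopen (congrSub_le_lowerTri l)
    (twist_infl_eq_one hϖ σ hl) v₀ with hf₀
  have hf₀0 : f₀ ≠ 0 := extendByZero_ne_zero _ _ _ hv₀
  obtain ⟨hM, hΦb⟩ := isIrreducible_of_injective Φ hΦi ⟨f₀, hf₀0⟩
  have hηN := etaHat_eq_one hϖ hψ ω hl hNG
  have hT : average hopen hNG hηN hNH hχN ≠ 0 := by
    apply average_ne_zero
    intro g hg hg'
    -- With g₁₂ = ϖ^ℓ c, both characters become ω(g₁₁) ψ(g₁₁⁻¹ c).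
    obtain ⟨c, hc⟩ := (mem_maximalIdeal_pow hϖ).1 hg'.1
    rw [hχf ⟨g, hg'⟩ (Gam.a ⟨g, hg⟩) c rfl hc]
    change (inflChar ω (Gam.a (⟨g, hg⟩ : Gam F l)) : ℂ) * ψ (((ϖ : F) ^ l)⁻¹ *
      (((Gam.a (⟨g, hg⟩ : Gam F l))⁻¹ : (𝒪[F])ˣ) * g 0 1 : 𝒪[F])) = _
    rw [hc, mul_left_comm, inv_pow_mul_pow_mul hϖ]
  have hJ' : (ind (Gam F l) (charRep (etaHat ψ hψ ϖ hϖ (inflChar ω) l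
    (inflChar_trivialOn ω hl)))).IsIrreducible := hJ
  have hTb := (Representation.IsIrreducible.bijective_or_eq_zero
    (average hopen hNG hηN hNH hχN)).resolve_right hT
  refine ⟨⟨((average hopen hNG hηN hNH hχN).ofBijective hTb).trans (Φ.ofBijective hΦb).symm⟩, hM,
    ⟨f₀, hf₀0, fun k hk => ?_⟩, ?_⟩
  · ext g
    exact apply_mul_right_of_mem (congrSub_le_lowerTri l) (twist_infl_eq_one hϖ σ hl) f₀ hk g
  · rintro n ⟨f, hf, hfix⟩
    by_contra! hn
    -- If n < ℓ then K_ℓ ⊆ K_{n+1}, so a vector fixed by K_{n+1} is fixed by K_ℓ.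
    exact hf (eq_zero_of_congrSub_fixed hϖ σ hσ.2 hl f fun k hk =>
      hfix k (congrSub_antitone (by omega) hk))
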